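/- Let $a,b,c,d,p,q\in\mathbb R$ with $ad-bc=1$ and $b\neq 0$, and write $A=\{a,b,c,d,p,q\}$. For $f\in L^1(\mathbb R)$ let $$\mathscr F_A f(\omega)=\frac1{\sqrt{|b|}}\int_{\mathbb R} f(t)\,e^{\frac{\pi i}{b}(at^2+2pt-2\omega t+2(bq-dp)\omega+d\omega^2)}\,dt,\qquad \omega\in\mathbb R,$$ be the special affine Fourier transform (SAFT); on $L^2(\mathbb R)$, $\mathscr F_A$ denotes the continuous extension of this operator from $L^1(\mathbb R)\cap L^2(\mathbb R)$. Let $$\lambda_A(t)=e^{\frac{\pi i}{b}at^2},\qquad \rho_A(t)=e^{\frac{\pi i}{b}(at^2+2pt)},\qquad \eta_A(t)=e^{\frac{\pi i}{b}(dt^2+2(bq-dp)t)} .$$ Fix a window $g\in\mathcal S(\mathbb R)$, $g\ne0$. For a tempered distribution $f$ let $V_gf(x,\omega)=\langle f,\ \overline{g(\cdot-x)}\,e^{-2\pi i\omega\,\cdot}\rangle$ (bilinear pairing), and let $$S_0(\mathbb R)=M^1(\mathbb R)=\Big\{f\in\mathcal S'(\mathbb R):\ \|f\|_{S_0}=\iint_{\mathbb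 R^2}|V_gf(x,\omega)|\,dx\,d\omega<\infty\Big\}.$$ Let $S_0'(\mathbb R)$ be the dual of $S_0(\mathbb R)$. Then $S_0(\mathbb R)$ is a Banach space that is continuously and densely embedded in $L^2(\mathbb R)$ (as subspaces of $\mathcal S'(\mathbb R)$), and $L^2(\mathbb R)$ is weak*-continuously and weak*-densely embedded in $S_0'(\mathbb R)$ by $h\mapsto\big(f\mapsto\int_{\mathbb R} hf\big)$; that is, $(S_0(\mathbb R),L^2(\mathbb R),S_0'(\mathbb R))$ is a Banach Gelfand triple. A (unitary) Gelfand triple automorphism of it is a unitary operator $T$ on $L^2(\mathbb R)$ which restricts to a Banach space isomorphism (linear homeomorphism) of $S_0(\mathbb R)$ onto itself and extends to a linear bijection of $S_0'(\mathbb R)$ onto itself that is a homeomorphism both for the norm topology and for the weak* topology. (i) The operator $\mathscr F_A$ is a unitary Gelfand triple automorphism of $(S_0(\mathbb R),L^2(\mathbb R),S_0'(\mathbb R))$. (ii) The operators of pointwise multiplication by $\lambda_A$, by $\rho_A$ and by $\eta_A$ are unitary Gelfand triple automorphisms of $(S_0(\mathbb R),L^2(\mathbb R),S_0'(\mathbb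 R))$. -/

import Mathlib

open MeasureTheory Complex ENNReal
open scoped SchwartzMap FourierTransform

/-- The Hilbert space `L²(ℝ)` of complex-valued functions. -/
abbrev L2R : Type := Lp ℂ 2 (volume : Measure ℝ)

/-- The character `t ↦ e^{-2πiωt}`. -/
noncomputable def charFn (ω : ℝ) (t : ℝ) : ℂ :=
  cexp (-(2 * Real.pi * I * ω * t))

theorem charFn_hasTemperateGrowth (ω : ℝ) : (charFn ω).HasTemperateGrowth := by
  have key : ∀ n : ℕ, iteratedDeriv n (charFn ω)
      = fun t : ℝ => (-(2 * Real.pi * I * ω)) ^ n * charFn ω t := by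
    intro n
    induction n with
    | zero => ext t; simp
    | succ k ih =>
      rw [iteratedDeriv_succ, ih]
      ext t
      have h1 : HasDerivAt (fun t : ℝ => -(2 * Real.pi * I * ω * (t : ℂ)))
          (-(2 * Real.pi * I * ω)) t := by
        have h0 := ((Complex.ofRealCLM.hasDerivAt (x := t)).const_mul
          (2 * Real.pi * I * (ω : ℂ))).neg
        simp only [Complex.ofRealCLM_apply, Complex.ofReal_one, mul_one] at h0
        exact h0
      have h2 := (h1.cexp).const_mul ((-(2 * Real.pi * I * (ω : ℂ))) ^ k)
      rw [show (fun t : ℝ => (-(2 * Real.pi * I * (ω : ℂ))) ^ k * charFn ω t)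
        = fun t : ℝ => (-(2 * Real.pi * I * (ω : ℂ))) ^ k *
          cexp (-(2 * Real.pi * I * ω * (t : ℂ))) from rfl, h2.deriv]
      simp only [charFn]
      ring
  refine ⟨?_, fun n => ⟨0, ‖(-(2 * Real.pi * I * (ω : ℂ))) ^ n‖, fun t => ?_⟩⟩
  · have h : ContDiff ℝ (⊤ : ℕ∞) (fun t : ℝ => (t : ℂ)) := Complex.ofRealCLM.contDiff
    exact (contDiff_const.mul h).neg.cexp
  · rw [norm_iteratedFDeriv_eq_norm_iteratedDeriv, key n]
    have : ‖charFn ω t‖ = 1 := by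
      rw [charFn, show -(2 * Real.pi * I * ω * (t : ℂ))
        = ((-(2 * Real.pi * ω * t) : ℝ) : ℂ) * I by push_cast; ring]
      exact Complex.norm_exp_ofReal_mul_I _
    simp [this]

/-- The Schwartz function `t ↦ e^{-2πiωt} · conj (g (t - x))`, that is, the complex conjugate of
the time-frequency shift `M_ω T_x g`. -/
noncomputable def conjShift (g : 𝓢(ℝ, ℂ)) (x ω : ℝ) : 𝓢(ℝ, ℂ) :=
  SchwartzMap.smulLeftCLM ℂ (charFn ω)
    (SchwartzMap.compSubConstCLM ℝ x
      (SchwartzMap.postcompCLM (conjCLE : ℂ →L[ℝ] ℂ) g))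

theorem conjShift_apply (g : 𝓢(ℝ, ℂ)) (x ω t : ℝ) :
    conjShift g x ω t = cexp (-(2 * Real.pi * I * ω * t)) * (starRingEnd ℂ) (g (t - x)) := by
  simp [conjShift, charFn_hasTemperateGrowth, charFn]

/-- The short time Fourier transform `V_g f(x, ω) = f(conj (M_ω T_x g))` of a tempered
distribution `f`; for a function `f` it is `∫ f(t) conj (g(t - x)) e^{-2πiωt} dt`. -/
noncomputable def stft (g : 𝓢(ℝ, ℂ)) (f : 𝓢'(ℝ, ℂ)) (z : ℝ × ℝ) : ℂ :=
  f (conjShift g z.1 z.2)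

theorem stft_L2_eq_integral (g : 𝓢(ℝ, ℂ)) (f : L2R) (x ω : ℝ) :
    stft g (Lp.toTemperedDistribution f) (x, ω)
      = ∫ t : ℝ, f t * (starRingEnd ℂ) (g (t - x)) * cexp (-(2 * Real.pi * I * ω * t)) := by
  simp only [stft, Lp.toTemperedDistribution_apply, conjShift_apply, smul_eq_mul]
  refine integral_congr_ae (Filter.Eventually.of_forall fun t => ?_)
  simp only
  ring

/-- `M¹(ℝ)` as a subspace of the tempered distributions: those `f` for which `V_g f` is integrable
over the time-frequency plane. -/
noncomputable def S0Submodule (g : 𝓢(ℝ, ℂ)) : Submodule ℂ 𝓢'(ℝ, ℂ) where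
  carrier := {f | Integrable (stft g f) (volume : Measure (ℝ × ℝ))}
  add_mem' {u v} hu hv := Integrable.add (f := stft g u) (g := stft g v) hu hv
  zero_mem' := by
    have : stft g 0 = 0 := rfl
    simp [this]
  smul_mem' c u hu := Integrable.smul (f := stft g u) c hu

/-- The space `S₀(ℝ) = M¹(ℝ)`, with the norm `‖f‖ = ∬ |V_g f(x, ω)| dx dω` given by the window
`g`. (A type of its own, so that it carries this norm and not the topology of `𝓢'(ℝ)`.) -/
def S0 (g : 𝓢(ℝ, ℂ)) : Type := S0Submodule g

namespace S0

variable {g : 𝓢(ℝ, ℂ)}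

noncomputable instance : AddCommGroup (S0 g) := inferInstanceAs (AddCommGroup (S0Submodule g))

noncomputable instance : Module ℂ (S0 g) := inferInstanceAs (Module ℂ (S0Submodule g))

/-- The inclusion of `S₀(ℝ)` into the tempered distributions. -/
noncomputable def toDistribution : S0 g →ₗ[ℂ] 𝓢'(ℝ, ℂ) := (S0Submodule g).subtype

theorem integrable_stft (f : S0 g) : Integrable (stft g (toDistribution f)) := f.2

noncomputable instance : Norm (S0 g) := ⟨fun f => ∫ z : ℝ × ℝ, ‖stft g (toDistribution f) z‖⟩

theorem norm_def (f : S0 g) : ‖f‖ = ∫ z : ℝ × ℝ, ‖stft g (toDistribution f) z‖ := rfl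

theorem norm_smul_eq (c : ℂ) (f : S0 g) : ‖c • f‖ = ‖c‖ * ‖f‖ := by
  rw [norm_def, norm_def, ← integral_const_mul]
  refine integral_congr_ae (Filter.Eventually.of_forall fun z => ?_)
  have : stft g (toDistribution (c • f)) z = c * stft g (toDistribution f) z := by
    rw [map_smul]; rfl
  simp only [this, norm_mul]

theorem norm_add_le' (u v : S0 g) : ‖u + v‖ ≤ ‖u‖ + ‖v‖ := by
  have h : stft g (toDistribution (u + v))
      = stft g (toDistribution u) + stft g (toDistribution v) := by
    rw [map_add]; rfl
  rw [norm_def, norm_def, norm_def,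
    ← integral_add (integrable_stft u).norm (integrable_stft v).norm]
  refine integral_mono (integrable_stft (u + v)).norm
    ((integrable_stft u).norm.add (integrable_stft v).norm) fun z => ?_
  rw [h]
  exact norm_add_le _ _

noncomputable instance : SeminormedAddCommGroup (S0 g) :=
  SeminormedAddCommGroup.ofCore (𝕜 := ℂ)
    { norm_nonneg := fun _ => integral_nonneg fun _ => norm_nonneg _
      norm_smul := norm_smul_eq
      norm_triangle := norm_add_le' }

noncomputable instance : NormedSpace ℂ (S0 g) where
  norm_smul_le c f := (norm_smul_eq c f).le

end S0

/-- The embedding `H → B'` of `H = L²(ℝ)` that is dual to an embedding `j : B → H`: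
it sends `h` to the functional `f ↦ ∫ h(t) (j f)(t) dt`. -/
noncomputable def dualEmbedding {B : Type*} [SeminormedAddCommGroup B] [NormedSpace ℂ B]
    (j : B →L[ℂ] L2R) : L2R →L[ℂ] StrongDual ℂ B :=
  (ContinuousLinearMap.compL ℂ B L2R ℂ).flip j ∘L
    (ContinuousLinearMap.mul ℂ ℂ).lpPairing volume 2 2

theorem dualEmbedding_apply {B : Type*} [SeminormedAddCommGroup B] [NormedSpace ℂ B]
    (j : B →L[ℂ] L2R) (h : L2R) (f : B) :
    dualEmbedding j h f = ∫ t : ℝ, h t * j f t := by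
  simp [dualEmbedding, ContinuousLinearMap.lpPairing_eq_integral]

/-- `(B, H, B')` is a Banach Gelfand triple with respect to the maps `j : B → H` and
`i : H → B'`: `B` is a Banach space embedded continuously and densely into `H`, and `H` is
embedded weak*-continuously and weak*-densely into `B'`. -/
structure IsBanachGelfandTriple {B H : Type*} [SeminormedAddCommGroup B] [NormedSpace ℂ B]
    [NormedAddCommGroup H] [InnerProductSpace ℂ H]
    (j : B →L[ℂ] H) (i : H →L[ℂ] StrongDual ℂ B) : Prop where
  norm_definite : ∀ f : B, ‖f‖ = 0 → f = 0
  complete : CompleteSpace B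
  complete_hilbert : CompleteSpace H
  injective : Function.Injective j
  denseRange : DenseRange j
  dual_injective : Function.Injective i
  dual_continuous : Continuous fun h : H => StrongDual.toWeakDual (i h)
  dual_denseRange : DenseRange fun h : H => StrongDual.toWeakDual (i h)

/-- The operator `T` on `H` is a (unitary) Gelfand triple automorphism of `(B, H, B')`:
it is unitary on `H`, it restricts to an isomorphism of the Banach space `B`, and it extends to an
isomorphism of `B'` for the norm topology that is also one for the weak* topology. -/
structure IsGelfandTripleAutomorphism {B H : Type*} [SeminormedAddCommGroup B] [NormedSpace ℂ B]
    [NormedAddCommGroup H] [InnerProductSpace ℂ H]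
    (j : B →L[ℂ] H) (i : H →L[ℂ] StrongDual ℂ B) (T : H → H) : Prop where
  restricts : ∃ T₀ : B ≃L[ℂ] B, ∀ f : B, j (T₀ f) = T (j f)
  unitary : ∃ U : H ≃ₗᵢ[ℂ] H, ∀ h : H, U h = T h
  extends_dual : ∃ T' : StrongDual ℂ B ≃L[ℂ] StrongDual ℂ B,
    (∀ h : H, T' (i h) = i (T h)) ∧
    (Continuous fun u : WeakDual ℂ B => StrongDual.toWeakDual (T' (WeakDual.toStrongDual u))) ∧
    (Continuous fun u : WeakDual ℂ B =>
      StrongDual.toWeakDual (T'.symm (WeakDual.toStrongDual u)))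

/-- `λ_A(t) = exp((πi/b) a t²)`. -/
noncomputable def chirpLam (a b : ℝ) (t : ℝ) : ℂ :=
  cexp (Real.pi * I / b * (a * t ^ 2))

/-- `ρ_A(t) = exp((πi/b) (a t² + 2 p t))`. -/
noncomputable def chirpRho (a b p : ℝ) (t : ℝ) : ℂ :=
  cexp (Real.pi * I / b * (a * t ^ 2 + 2 * p * t))

/-- `η_A(ω) = exp((πi/b) (d ω² + 2 (bq - dp) ω))`. -/
noncomputable def chirpEta (b d p q : ℝ) (ω : ℝ) : ℂ :=
  cexp (Real.pi * I / b * (d * ω ^ 2 + 2 * (b * q - d * p) * ω))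

/-- The integral of the special affine Fourier transform of an integrable function `f`. -/
noncomputable def saft (a b d p q : ℝ) (f : ℝ → ℂ) (ω : ℝ) : ℂ :=
  1 / (Real.sqrt |b| : ℂ) * ∫ t : ℝ, f t *
    cexp (Real.pi * I / b *
      (a * t ^ 2 + 2 * p * t - 2 * ω * t + 2 * (b * q - d * p) * ω + d * ω ^ 2))

/-! ### Time-frequency shifts of Schwartz functions -/

/-! Everything rests on the reproducing formula `integral_mul_temperedDistribution`: for Schwartz
`φ, g, h` and a tempered `f`, integrating `f (tfShift h z)` against the rapidly decaying matrix
coefficient of `φ` and `g` returns `(∫ g h) f φ`. For functions this is Fourier inversion in the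
frequency variable followed by integration over translations. It passes to distributions because a
tempered `f` factors through finitely many weighted derivatives with values in a Banach space, where
continuous functionals commute with Bochner integrals.

The formula has two consequences. With a shifted Schwartz function as `φ` it bounds one short time
Fourier transform by the convolution of another with an integrable kernel, so changing the window
costs only a constant in L¹ norm (`exists_window_change`). With `h` the conjugate of `g` it recovers
`f` in `S₀` from an absolutely convergent L²-valued integral of shifts of `g`, which gives the
embedding into L². Completeness of `S₀` is then Fatou's lemma, and weak* density is a Hahn–Banach
argument.

For the operators it suffices that the transpose for the bilinear pairing sends each family of
shifts of a Schwartz function to another such family, up to phases and an area preserving map of the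
plane (`IsMetaplecticPair`). Then `|V_g (T f)|` is a rearrangement of `|V f|` for another window,
hence integrable with control. Applied to the inverse, this makes `T` an isomorphism of `S₀`;
applied to the transpose, it gives the extension to `S₀'` as an adjoint. The Fourier transform acts
on the plane by a quarter turn and a chirped dilation by a shear and a squeeze. The SAFT is chirp
multiplication, Fourier transform and chirped dilation in succession, and each of `λ_A`, `ρ_A`,
`η_A` is a single chirp. -/

theorem norm_charFn (ω t : ℝ) : ‖charFn ω t‖ = 1 := by
  rw [charFn, show -(2 * Real.pi * I * ω * (t : ℂ))
    = ((-(2 * Real.pi * ω * t) : ℝ) : ℂ) * I by push_cast; ring]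
  exact Complex.norm_exp_ofReal_mul_I _

theorem norm_charFn_sub_le (ω ω' t : ℝ) :
    ‖charFn ω t - charFn ω' t‖ ≤ 2 * Real.pi * |ω - ω'| * |t| := by
  have h : charFn ω t = charFn ω' t * charFn (ω - ω') t := by
    simp only [charFn, ← Complex.exp_add]
    congr 1
    push_cast
    ring
  rw [h, show charFn ω' t * charFn (ω - ω') t - charFn ω' t
    = charFn ω' t * (charFn (ω - ω') t - 1) by ring, norm_mul, norm_charFn, one_mul, charFn,
    show -(2 * Real.pi * I * ((ω - ω' : ℝ) : ℂ) * (t : ℂ))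
      = I * ((-(2 * Real.pi * (ω - ω') * t) : ℝ) : ℂ) by push_cast; ring]
  refine (Real.norm_exp_I_mul_ofReal_sub_one_le).trans (le_of_eq ?_)
  rw [Real.norm_eq_abs, abs_neg, abs_mul, abs_mul, abs_of_pos (by positivity : 0 < 2 * Real.pi)]

/-- The Schwartz function `t ↦ e^{-2πiωt} h (t - x)` for `z = (x, ω)`. -/
noncomputable def tfShift (h : 𝓢(ℝ, ℂ)) (z : ℝ × ℝ) : 𝓢(ℝ, ℂ) :=
  SchwartzMap.smulLeftCLM ℂ (charFn z.2) (SchwartzMap.compSubConstCLM ℝ z.1 h)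

@[simp]
theorem tfShift_apply (h : 𝓢(ℝ, ℂ)) (z : ℝ × ℝ) (t : ℝ) :
    tfShift h z t = charFn z.2 t * h (t - z.1) := by
  simp [tfShift, charFn_hasTemperateGrowth]

/-- The complex conjugate of a Schwartz function. -/
noncomputable def conjSchwartz (g : 𝓢(ℝ, ℂ)) : 𝓢(ℝ, ℂ) :=
  SchwartzMap.postcompCLM (conjCLE : ℂ →L[ℝ] ℂ) g

@[simp]
theorem conjSchwartz_apply (g : 𝓢(ℝ, ℂ)) (t : ℝ) :
    conjSchwartz g t = (starRingEnd ℂ) (g t) := rfl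

@[simp]
theorem conjSchwartz_conjSchwartz (g : 𝓢(ℝ, ℂ)) : conjSchwartz (conjSchwartz g) = g := by
  ext t
  simp

theorem stft_eq (g : 𝓢(ℝ, ℂ)) (f : 𝓢'(ℝ, ℂ)) (z : ℝ × ℝ) :
    stft g f z = f (tfShift (conjSchwartz g) z) := rfl

/-- Multiplication of Schwartz functions by the variable. -/
noncomputable def mulVar : 𝓢(ℝ, ℂ) →L[ℂ] 𝓢(ℝ, ℂ) :=
  SchwartzMap.smulLeftCLM ℂ (fun t : ℝ => (t : ℂ))

@[simp]
theorem mulVar_apply (h : 𝓢(ℝ, ℂ)) (t : ℝ) : mulVar h t = t * h t := by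
  rw [mulVar, SchwartzMap.smulLeftCLM_apply_apply Function.Complex.hasTemperateGrowth_ofReal,
    smul_eq_mul]

/-- From `t = (t - x) + x`. This and the analogous rule for the derivative are the source of the
polynomial growth in `z`. -/
theorem mulVar_tfShift (h : 𝓢(ℝ, ℂ)) (z : ℝ × ℝ) :
    mulVar (tfShift h z) = tfShift (mulVar h) z + (z.1 : ℂ) • tfShift h z := by
  ext t
  simp
  ring

theorem hasDerivAt_charFn (ω t : ℝ) :
    HasDerivAt (charFn ω) (-(2 * Real.pi * I * ω) * charFn ω t) t := by
  have h1 : HasDerivAt (fun t : ℝ => -(2 * Real.pi * I * ω * (t : ℂ)))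
      (-(2 * Real.pi * I * ω)) t := by
    have h0 := ((Complex.ofRealCLM.hasDerivAt (x := t)).const_mul
      (2 * Real.pi * I * (ω : ℂ))).neg
    simp only [Complex.ofRealCLM_apply, Complex.ofReal_one, mul_one] at h0
    exact h0
  have := h1.cexp
  exact this.congr_deriv (mul_comm _ _)

theorem derivCLM_tfShift (h : 𝓢(ℝ, ℂ)) (z : ℝ × ℝ) :
    SchwartzMap.derivCLM ℂ ℂ (tfShift h z)
      = tfShift (SchwartzMap.derivCLM ℂ ℂ h) z - (2 * Real.pi * I * z.2) • tfShift h z := by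
  ext t
  rw [SchwartzMap.derivCLM_apply,
    show ⇑(tfShift h z) = fun t => charFn z.2 t * h (t - z.1) from funext (tfShift_apply h z)]
  have h2 : HasDerivAt (fun t => h (t - z.1)) (deriv h (t - z.1)) t :=
    (h.hasDerivAt (t - z.1)).comp_sub_const t z.1
  rw [((hasDerivAt_charFn z.2 t).fun_mul h2).deriv]
  simp
  ring

/-- The map `φ ↦ (t ↦ t ^ k * φ⁽ⁿ⁾(t))` from Schwartz functions to bounded continuous functions. -/
noncomputable def weightedDeriv (k n : ℕ) : 𝓢(ℝ, ℂ) →L[ℂ] BoundedContinuousFunction ℝ ℂ :=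
  SchwartzMap.toBoundedContinuousFunctionCLM ℂ ℝ ℂ ∘L
    (mulVar ^ k) ∘L (SchwartzMap.derivCLM ℂ ℂ ^ n)

theorem mulVar_pow_apply (k : ℕ) (h : 𝓢(ℝ, ℂ)) (t : ℝ) :
    (mulVar ^ k) h t = (t : ℂ) ^ k * h t := by
  induction k generalizing h with
  | zero => simp
  | succ k ih =>
    rw [pow_succ, mul_apply_eq_comp, ih, mulVar_apply]
    ring

theorem derivCLM_pow_apply (n : ℕ) (h : 𝓢(ℝ, ℂ)) :
    ⇑((SchwartzMap.derivCLM ℂ ℂ ^ n) h) = iteratedDeriv n h := by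
  induction n with
  | zero => simp
  | succ n ih =>
    rw [pow_succ', mul_apply_eq_comp, iteratedDeriv_succ, ← ih]
    rfl

theorem weightedDeriv_apply (k n : ℕ) (h : 𝓢(ℝ, ℂ)) (t : ℝ) :
    weightedDeriv k n h t = (t : ℂ) ^ k * (SchwartzMap.derivCLM ℂ ℂ ^ n) h t := by
  rw [← mulVar_pow_apply]
  rfl

/-- Trades the Schwartz seminorms for norms of linear maps into a Banach space, where Bochner
integrals can be used. -/
theorem seminorm_le_norm_weightedDeriv (k n : ℕ) (h : 𝓢(ℝ, ℂ)) :
    SchwartzMap.seminorm ℂ k n h ≤ ‖weightedDeriv k n h‖ := by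
  refine SchwartzMap.seminorm_le_bound' ℂ k n h (norm_nonneg _) fun t => ?_
  have := (weightedDeriv k n h).norm_coe_le_norm t
  rwa [weightedDeriv_apply, derivCLM_pow_apply, norm_mul, norm_pow, Complex.norm_real] at this

/-- A continuous linear map on Schwartz functions is moderate if its values on the time-frequency
shifts of a fixed function depend continuously on the shift and grow at most polynomially. -/
def IsModerate {E : Type*} [NormedAddCommGroup E] [NormedSpace ℂ E] (S : 𝓢(ℝ, ℂ) →L[ℂ] E) : Prop :=
  ∀ h : 𝓢(ℝ, ℂ), Continuous (fun z => S (tfShift h z)) ∧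
    ∃ (C : ℝ) (m : ℕ), ∀ z, ‖S (tfShift h z)‖ ≤ C * (1 + ‖z‖) ^ m

section
variable {E : Type*} [NormedAddCommGroup E] [NormedSpace ℂ E] {S : 𝓢(ℝ, ℂ) →L[ℂ] E}

theorem exists_bound_add_smul {F G : ℝ × ℝ → E} {ℓ : ℝ × ℝ → ℂ} {K : ℝ} (hK : 0 ≤ K)
    (hF : ∃ (C : ℝ) (m : ℕ), ∀ z, ‖F z‖ ≤ C * (1 + ‖z‖) ^ m)
    (hG : ∃ (C : ℝ) (m : ℕ), ∀ z, ‖G z‖ ≤ C * (1 + ‖z‖) ^ m)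
    (hℓ : ∀ z, ‖ℓ z‖ ≤ K * ‖z‖) :
    ∃ (C : ℝ) (m : ℕ), ∀ z, ‖F z + ℓ z • G z‖ ≤ C * (1 + ‖z‖) ^ m := by
  obtain ⟨C, m, hC⟩ := hF
  obtain ⟨C', m', hC'⟩ := hG
  refine ⟨|C| + K * |C'|, m + m' + 1, fun z => ?_⟩
  have h1 : (1 : ℝ) ≤ 1 + ‖z‖ := by simp
  have hz : ‖z‖ ≤ 1 + ‖z‖ := by simp
  calc ‖F z + ℓ z • G z‖ ≤ ‖F z‖ + ‖ℓ z‖ * ‖G z‖ := (norm_add_le _ _).trans (by rw [norm_smul])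
    _ ≤ |C| * (1 + ‖z‖) ^ m + (K * (1 + ‖z‖)) * (|C'| * (1 + ‖z‖) ^ m') := by
        gcongr
        · exact (hC z).trans (by gcongr; exact le_abs_self C)
        · exact (hℓ z).trans (by gcongr)
        · exact (hC' z).trans (by gcongr; exact le_abs_self C')
    _ = |C| * (1 + ‖z‖) ^ m + K * |C'| * (1 + ‖z‖) ^ (m' + 1) := by ring
    _ ≤ |C| * (1 + ‖z‖) ^ (m + m' + 1) + K * |C'| * (1 + ‖z‖) ^ (m + m' + 1) := by
        gcongr <;> first | exact h1 | omega
    _ = _ := by ring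

/-- Stability under `mulVar` and `derivCLM` reduces moderateness of every `weightedDeriv k n` to
that of the inclusion into bounded functions. -/
theorem IsModerate.comp_mulVar (hS : IsModerate S) : IsModerate (S ∘L mulVar) := by
  intro h
  have key : (fun z => (S ∘L mulVar) (tfShift h z))
      = fun z => S (tfShift (mulVar h) z) + (z.1 : ℂ) • S (tfShift h z) := by
    ext z
    simp [mulVar_tfShift]
  refine ⟨?_, ?_⟩
  · rw [key]
    exact (hS _).1.add ((Complex.continuous_ofReal.comp continuous_fst).smul (hS h).1)
  · simp_rw [fun z => congrFun key z]
    refine exists_bound_add_smul zero_le_one (hS _).2 (hS h).2 fun z => ?_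
    simpa using norm_fst_le z

theorem IsModerate.comp_derivCLM (hS : IsModerate S) :
    IsModerate (S ∘L SchwartzMap.derivCLM ℂ ℂ) := by
  intro h
  have key : (fun z => (S ∘L SchwartzMap.derivCLM ℂ ℂ) (tfShift h z))
      = fun z => S (tfShift (SchwartzMap.derivCLM ℂ ℂ h) z)
        + (-(2 * Real.pi * I * z.2)) • S (tfShift h z) := by
    ext z
    simp [derivCLM_tfShift, sub_eq_add_neg]
  refine ⟨?_, ?_⟩
  · rw [key]
    refine (hS _).1.add (Continuous.smul ?_ (hS h).1)
    fun_prop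
  · simp_rw [fun z => congrFun key z]
    refine exists_bound_add_smul (K := 2 * Real.pi) (by positivity) (hS _).2 (hS h).2 fun z => ?_
    simpa [abs_of_pos Real.pi_pos] using
      mul_le_mul_of_nonneg_left (norm_snd_le z) (by positivity : 0 ≤ 2 * Real.pi)

end

theorem isModerate_toBoundedContinuousFunctionCLM :
    IsModerate (SchwartzMap.toBoundedContinuousFunctionCLM ℂ ℝ ℂ) := by
  intro h
  set M₀ := SchwartzMap.seminorm ℂ 0 0 h
  set M₁ := SchwartzMap.seminorm ℂ 1 0 h
  set N := SchwartzMap.seminorm ℂ 0 1 h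
  have hM₀ : ∀ t, ‖h t‖ ≤ M₀ := fun t => SchwartzMap.norm_le_seminorm ℂ h t
  have hM₁ : ∀ t, |t| * ‖h t‖ ≤ M₁ := fun t => by
    simpa using SchwartzMap.norm_pow_mul_le_seminorm ℂ h 1 t
  have hN : ∀ s t, ‖h s - h t‖ ≤ N * |s - t| := fun s t => by
    refine Convex.norm_image_sub_le_of_norm_deriv_le (s := Set.univ) (f := h)
      (fun x _ => h.differentiableAt) (fun x _ => ?_) convex_univ (Set.mem_univ _) (Set.mem_univ _)
    simpa using SchwartzMap.le_seminorm' ℂ 0 1 h x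
  have hM₀' : 0 ≤ M₀ := apply_nonneg _ _
  have hM₁' : 0 ≤ M₁ := apply_nonneg _ _
  have hN' : 0 ≤ N := apply_nonneg _ _
  refine ⟨?_, M₀, 0, fun z => ?_⟩
  · rw [continuous_iff_continuousAt]
    intro z₀
    rw [ContinuousAt, tendsto_iff_norm_sub_tendsto_zero]
    -- The translation part is Lipschitz since `h'` is bounded; the modulation part costs a factor
    -- `|t|`, absorbed by the decay of `h`.
    refine squeeze_zero (g := fun z : ℝ × ℝ => N * |z.1 - z₀.1|
      + 2 * Real.pi * |z.2 - z₀.2| * (M₁ + |z₀.1| * M₀)) (fun _ => norm_nonneg _) (fun z => ?_) ?_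
    · rw [← map_sub]
      refine (BoundedContinuousFunction.norm_le (by positivity)).2 fun t => ?_
      simp only [SchwartzMap.toBoundedContinuousFunctionCLM_apply, sub_apply,
        tfShift_apply]
      have e : charFn z.2 t * h (t - z.1) - charFn z₀.2 t * h (t - z₀.1)
          = charFn z.2 t * (h (t - z.1) - h (t - z₀.1))
            + (charFn z.2 t - charFn z₀.2 t) * h (t - z₀.1) := by ring
      rw [e]
      refine (norm_add_le _ _).trans (add_le_add ?_ ?_)
      · rw [norm_mul, norm_charFn, one_mul]
        refine (hN _ _).trans (le_of_eq ?_)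
        rw [show t - z.1 - (t - z₀.1) = -(z.1 - z₀.1) by ring, abs_neg]
      · rw [norm_mul]
        have h1 : |t| * ‖h (t - z₀.1)‖ ≤ M₁ + |z₀.1| * M₀ := by
          calc |t| * ‖h (t - z₀.1)‖ ≤ (|t - z₀.1| + |z₀.1|) * ‖h (t - z₀.1)‖ := by
                gcongr
                simpa using abs_add_le (t - z₀.1) z₀.1
            _ = |t - z₀.1| * ‖h (t - z₀.1)‖ + |z₀.1| * ‖h (t - z₀.1)‖ := by ring
            _ ≤ _ := by
                gcongr
                · exact hM₁ _
                · exact hM₀ _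
        calc _ ≤ (2 * Real.pi * |z.2 - z₀.2| * |t|) * ‖h (t - z₀.1)‖ := by
                gcongr
                exact norm_charFn_sub_le _ _ _
          _ = 2 * Real.pi * |z.2 - z₀.2| * (|t| * ‖h (t - z₀.1)‖) := by ring
          _ ≤ _ := by gcongr
    · have : Continuous fun z : ℝ × ℝ => N * |z.1 - z₀.1|
          + 2 * Real.pi * |z.2 - z₀.2| * (M₁ + |z₀.1| * M₀) := by fun_prop
      simpa using this.tendsto z₀
  · rw [pow_zero, mul_one]
    refine (BoundedContinuousFunction.norm_le hM₀').2 fun t => ?_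
    simpa [norm_charFn] using hM₀ _

theorem isModerate_weightedDeriv (k n : ℕ) : IsModerate (weightedDeriv k n) := by
  have h1 : ∀ k, IsModerate (SchwartzMap.toBoundedContinuousFunctionCLM ℂ ℝ ℂ ∘L (mulVar ^ k)) := by
    intro k
    induction k with
    | zero => exact isModerate_toBoundedContinuousFunctionCLM
    | succ k ih => exact ih.comp_mulVar
  induction n with
  | zero => exact h1 k
  | succ n ih => exact ih.comp_derivCLM

theorem continuous_tfShift (h : 𝓢(ℝ, ℂ)) : Continuous (tfShift h) := by
  rw [continuous_iff_continuousAt]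
  intro z₀
  rw [ContinuousAt, (schwartz_withSeminorms ℂ ℝ ℂ).tendsto_nhds]
  rintro ⟨k, n⟩ ε hε
  have h1 : Filter.Tendsto (fun z => ‖weightedDeriv k n (tfShift h z)
      - weightedDeriv k n (tfShift h z₀)‖) (nhds z₀) (nhds 0) :=
    tendsto_iff_norm_sub_tendsto_zero.1 ((isModerate_weightedDeriv k n h).1.tendsto z₀)
  filter_upwards [h1.eventually_lt_const hε] with z hz
  rw [← map_sub] at hz
  exact (seminorm_le_norm_weightedDeriv k n _).trans_lt hz

/-! ### Tempered distributions commute with integrals -/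

/-- The bound forces `f` to vanish on the kernel of `ι`, so `f` descends to a bounded functional on
the range, which Hahn–Banach extends. -/
theorem LinearMap.exists_strongDual_comp_eq {V E : Type*} [AddCommGroup V] [Module ℂ V]
    [NormedAddCommGroup E] [NormedSpace ℂ E] (ι : V →ₗ[ℂ] E) (f : V →ₗ[ℂ] ℂ) (C : ℝ)
    (hf : ∀ v, ‖f v‖ ≤ C * ‖ι v‖) : ∃ F : StrongDual ℂ E, ∀ v, F (ι v) = f v := by
  -- `σ` is merely an algebraic section; continuity of `f ∘ σ` comes from `hf`.
  obtain ⟨σ, hσ⟩ := ι.rangeRestrict.exists_rightInverse_of_surjective ι.range_rangeRestrict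
  have hσ' : ∀ w : LinearMap.range ι, ι (σ w) = w := fun w =>
    congrArg Subtype.val (LinearMap.congr_fun hσ w)
  let f₀ : StrongDual ℂ (LinearMap.range ι) := (f ∘ₗ σ).mkContinuous C fun w => by
    have := hf (σ w)
    rwa [hσ'] at this
  obtain ⟨F, hF, -⟩ := exists_extension_norm_eq (LinearMap.range ι) f₀
  refine ⟨F, fun v => ?_⟩
  have h1 : F (ι v) = f (σ (ι.rangeRestrict v)) := hF (ι.rangeRestrict v)
  have h2 : ‖f (σ (ι.rangeRestrict v) - v)‖ ≤ 0 := by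
    refine (hf _).trans (le_of_eq ?_)
    rw [map_sub, hσ']
    simp
  rw [h1, ← sub_eq_zero, ← map_sub]
  simpa using h2

theorem exists_strongDual_weightedDeriv (f : 𝓢'(ℝ, ℂ)) :
    ∃ (s : Finset (ℕ × ℕ)) (F : StrongDual ℂ (s → BoundedContinuousFunction ℝ ℂ)),
      ∀ φ : 𝓢(ℝ, ℂ), f φ = F fun i => weightedDeriv i.1.1 i.1.2 φ := by
  let q : Seminorm ℂ 𝓢(ℝ, ℂ) := (normSeminorm ℂ ℂ).comp f.toLinearMap
  have hq : Continuous q := f.continuous.norm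
  obtain ⟨s, C, -, hC⟩ := Seminorm.bound_of_continuous (schwartz_withSeminorms ℂ ℝ ℂ) q hq
  let ι : 𝓢(ℝ, ℂ) →ₗ[ℂ] (s → BoundedContinuousFunction ℝ ℂ) :=
    LinearMap.pi fun i => (weightedDeriv i.1.1 i.1.2).toLinearMap
  obtain ⟨F, hF⟩ := LinearMap.exists_strongDual_comp_eq ι f.toLinearMap C fun φ => by
    refine (hC φ).trans ?_
    rw [smul_apply, NNReal.smul_def, smul_eq_mul]
    refine mul_le_mul_of_nonneg_left ?_ C.2
    refine Seminorm.finset_sup_apply_le (norm_nonneg _) fun i hi => ?_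
    refine (seminorm_le_norm_weightedDeriv i.1 i.2 φ).trans ?_
    exact norm_le_pi_norm (ι φ) ⟨i, hi⟩
  exact ⟨s, F, fun φ => (hF φ).symm⟩

section
variable {α : Type*} [MeasurableSpace α] {μ : Measure α} {Φ : α → 𝓢(ℝ, ℂ)} {ψ : 𝓢(ℝ, ℂ)}

theorem integrable_eval_of_integrable_weightedDeriv
    (hΦ : ∀ k n, Integrable (fun z => weightedDeriv k n (Φ z)) μ) (n : ℕ) (t : ℝ) :
    Integrable (fun z => (SchwartzMap.derivCLM ℂ ℂ ^ n) (Φ z) t) μ := by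
  have := (BoundedContinuousFunction.evalCLM ℂ t).integrable_comp (hΦ 0 n)
  simpa [weightedDeriv_apply] using this

theorem derivCLM_pow_eq_integral
    (hΦ : ∀ k n, Integrable (fun z => weightedDeriv k n (Φ z)) μ)
    (hψ : ∀ t, ψ t = ∫ z, Φ z t ∂μ) (n : ℕ) (t : ℝ) :
    (SchwartzMap.derivCLM ℂ ℂ ^ n) ψ t = ∫ z, (SchwartzMap.derivCLM ℂ ℂ ^ n) (Φ z) t ∂μ := by
  induction n generalizing t with
  | zero => simpa using hψ t
  | succ n ih =>
    have hd : ∀ (φ : 𝓢(ℝ, ℂ)) (t : ℝ), HasDerivAt ((SchwartzMap.derivCLM ℂ ℂ ^ n) φ)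
        ((SchwartzMap.derivCLM ℂ ℂ ^ (n + 1)) φ t) t := fun φ t => by
      rw [pow_succ', mul_apply_eq_comp]
      exact ((SchwartzMap.derivCLM ℂ ℂ ^ n) φ).hasDerivAt t
    have h1 := (hasDerivAt_integral_of_dominated_loc_of_deriv_le (μ := μ)
      (F := fun t z => (SchwartzMap.derivCLM ℂ ℂ ^ n) (Φ z) t)
      (F' := fun t z => (SchwartzMap.derivCLM ℂ ℂ ^ (n + 1)) (Φ z) t)
      -- The sup norm of the next derivative dominates uniformly in `t`, so differentiation under
      -- the integral is allowed.
      (x₀ := t) (s := Set.univ) (bound := fun z => ‖weightedDeriv 0 (n + 1) (Φ z)‖)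
      Filter.univ_mem
      (Filter.Eventually.of_forall fun t =>
        (integrable_eval_of_integrable_weightedDeriv hΦ n t).aestronglyMeasurable)
      (integrable_eval_of_integrable_weightedDeriv hΦ n t)
      (integrable_eval_of_integrable_weightedDeriv hΦ (n + 1) t).aestronglyMeasurable
      (Filter.Eventually.of_forall fun z t _ => by
        simpa [weightedDeriv_apply] using
          (weightedDeriv 0 (n + 1) (Φ z)).norm_coe_le_norm t)
      (hΦ 0 (n + 1)).norm
      (Filter.Eventually.of_forall fun z t _ => hd (Φ z) t)).2
    have h2 := hd ψ t
    rw [show ⇑((SchwartzMap.derivCLM ℂ ℂ ^ n) ψ)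
      = fun t => ∫ z, (SchwartzMap.derivCLM ℂ ℂ ^ n) (Φ z) t ∂μ from funext ih] at h2
    exact h2.unique h1

theorem weightedDeriv_eq_integral
    (hΦ : ∀ k n, Integrable (fun z => weightedDeriv k n (Φ z)) μ)
    (hψ : ∀ t, ψ t = ∫ z, Φ z t ∂μ) (k n : ℕ) :
    weightedDeriv k n ψ = ∫ z, weightedDeriv k n (Φ z) ∂μ := by
  ext t
  have := (BoundedContinuousFunction.evalCLM ℂ t).integral_comp_comm (hΦ k n)
  simp only [BoundedContinuousFunction.evalCLM_apply] at this
  rw [← this]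
  simp only [weightedDeriv_apply]
  rw [integral_const_mul, derivCLM_pow_eq_integral hΦ hψ]

theorem temperedDistribution_apply_eq_integral (f : 𝓢'(ℝ, ℂ))
    (hΦ : ∀ k n, Integrable (fun z => weightedDeriv k n (Φ z)) μ)
    (hψ : ∀ t, ψ t = ∫ z, Φ z t ∂μ) :
    f ψ = ∫ z, f (Φ z) ∂μ := by
  obtain ⟨s, F, hF⟩ := exists_strongDual_weightedDeriv f
  have hint : Integrable (fun z => fun i : s => weightedDeriv i.1.1 i.1.2 (Φ z)) μ :=
    Integrable.of_eval fun i => hΦ _ _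
  simp only [hF]
  rw [F.integral_comp_comm hint]
  congr 1
  ext1 i
  rw [weightedDeriv_eq_integral hΦ hψ, eval_integral fun i => hΦ _ _]

end

/-! ### Matrix coefficients of Schwartz functions -/

/-- The matrix coefficient `∫ φ(t) h(t - x) e^{-2πiωt} dt` at `z = (x, ω)`. -/
noncomputable def matCoeff (φ h : 𝓢(ℝ, ℂ)) (z : ℝ × ℝ) : ℂ := ∫ t, φ t * tfShift h z t

theorem integrable_mul_schwartz (φ ψ : 𝓢(ℝ, ℂ)) : Integrable (fun t => φ t * ψ t) :=
  (SchwartzMap.pairing (ContinuousLinearMap.mul ℂ ℂ) φ ψ).integrable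

theorem integral_mul_le (φ ψ : 𝓢(ℝ, ℂ)) :
    ‖∫ t, φ t * ψ t‖ ≤
      (∫ t, ‖φ t‖) * ‖SchwartzMap.toBoundedContinuousFunctionCLM ℂ ℝ ℂ ψ‖ := by
  rw [← integral_mul_const]
  refine norm_integral_le_of_norm_le (φ.integrable.norm.mul_const _)
    (Filter.Eventually.of_forall fun t => ?_)
  rw [norm_mul]
  gcongr
  exact (SchwartzMap.toBoundedContinuousFunctionCLM ℂ ℝ ℂ ψ).norm_coe_le_norm t

theorem continuous_matCoeff (φ h : 𝓢(ℝ, ℂ)) : Continuous (matCoeff φ h) := by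
  have h1 : Continuous fun ψ : 𝓢(ℝ, ℂ) => ∫ t, φ t * ψ t :=
    (SchwartzMap.integralCLM ℂ volume
      ∘L SchwartzMap.pairing (ContinuousLinearMap.mul ℂ ℂ) φ).continuous
  exact h1.comp (continuous_tfShift h)

theorem fst_mul_matCoeff (φ h : 𝓢(ℝ, ℂ)) (z : ℝ × ℝ) :
    (z.1 : ℂ) * matCoeff φ h z = matCoeff (mulVar φ) h z - matCoeff φ (mulVar h) z := by
  simp only [matCoeff]
  rw [← integral_const_mul, ← integral_sub (integrable_mul_schwartz _ _)
    (integrable_mul_schwartz _ _)]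
  refine integral_congr_ae (Filter.Eventually.of_forall fun t => ?_)
  simp
  ring

/-- Integration by parts, with the derivative of the modulation producing the factor in `ω`. -/
theorem snd_mul_matCoeff (φ h : 𝓢(ℝ, ℂ)) (z : ℝ × ℝ) :
    (2 * Real.pi * I * z.2) * matCoeff φ h z = matCoeff (SchwartzMap.derivCLM ℂ ℂ φ) h z
      + matCoeff φ (SchwartzMap.derivCLM ℂ ℂ h) z := by
  have h1 := SchwartzMap.integral_mul_deriv_eq_neg_deriv_mul φ (tfShift h z)
  have h2 : ∀ t, deriv (tfShift h z) t = tfShift (SchwartzMap.derivCLM ℂ ℂ h) z t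
      - (2 * Real.pi * I * z.2) * tfShift h z t := fun t => by
    have := congrArg (fun ψ : 𝓢(ℝ, ℂ) => ψ t) (derivCLM_tfShift h z)
    exact this
  simp only [h2] at h1
  have h3 : ∫ t, φ t * (tfShift (SchwartzMap.derivCLM ℂ ℂ h) z t
      - (2 * Real.pi * I * z.2) * tfShift h z t)
      = matCoeff φ (SchwartzMap.derivCLM ℂ ℂ h) z - (2 * Real.pi * I * z.2) * matCoeff φ h z := by
    simp only [matCoeff]
    rw [← integral_const_mul, ← integral_sub (integrable_mul_schwartz _ _)
      ((integrable_mul_schwartz _ _).const_mul _)]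
    refine integral_congr_ae (Filter.Eventually.of_forall fun t => ?_)
    simp only
    ring
  rw [h3] at h1
  have h4 : ∫ t, deriv φ t * tfShift h z t = matCoeff (SchwartzMap.derivCLM ℂ ℂ φ) h z := rfl
  rw [h4] at h1
  linear_combination -h1

/-- Each factor `x` or `ω` can be moved onto `φ` and `h`, which stay Schwartz; hence the induction
with both functions varying. -/
theorem exists_bound_matCoeff (i j : ℕ) (φ h : 𝓢(ℝ, ℂ)) :
    ∃ C, ∀ z, |z.1| ^ i * |z.2| ^ j * ‖matCoeff φ h z‖ ≤ C := by
  induction i generalizing φ h with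
  | zero =>
    induction j generalizing φ h with
    | zero =>
      refine ⟨(∫ t, ‖φ t‖) * SchwartzMap.seminorm ℂ 0 0 h, fun z => ?_⟩
      rw [pow_zero, pow_zero, one_mul, one_mul]
      refine (integral_mul_le _ _).trans ?_
      gcongr
      refine (BoundedContinuousFunction.norm_le (apply_nonneg _ _)).2 fun t => ?_
      simpa [norm_charFn] using SchwartzMap.norm_le_seminorm ℂ h _
    | succ j ih =>
      obtain ⟨C, hC⟩ := ih (SchwartzMap.derivCLM ℂ ℂ φ) h
      obtain ⟨C', hC'⟩ := ih φ (SchwartzMap.derivCLM ℂ ℂ h)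
      refine ⟨C + C', fun z => ?_⟩
      have e := congrArg norm (snd_mul_matCoeff φ h z)
      simp only [norm_mul, Complex.norm_ofNat, Complex.norm_real, Complex.norm_I, mul_one,
        Real.norm_eq_abs, abs_of_pos Real.pi_pos] at e
      have h2 : |z.2| * ‖matCoeff φ h z‖ ≤ 2 * Real.pi * |z.2| * ‖matCoeff φ h z‖ := by
        gcongr
        nlinarith [Real.two_le_pi, abs_nonneg z.2]
      calc _ = |z.1| ^ 0 * |z.2| ^ j * (|z.2| * ‖matCoeff φ h z‖) := by ring
        _ ≤ |z.1| ^ 0 * |z.2| ^ j * (‖matCoeff (SchwartzMap.derivCLM ℂ ℂ φ) h z‖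
            + ‖matCoeff φ (SchwartzMap.derivCLM ℂ ℂ h) z‖) := by
          gcongr
          exact (h2.trans e.le).trans (norm_add_le _ _)
        _ ≤ _ := by
          rw [mul_add]
          exact add_le_add (hC z) (hC' z)
  | succ i ih =>
    obtain ⟨C, hC⟩ := ih (mulVar φ) h
    obtain ⟨C', hC'⟩ := ih φ (mulVar h)
    refine ⟨C + C', fun z => ?_⟩
    have e := congrArg norm (fst_mul_matCoeff φ h z)
    rw [norm_mul, Complex.norm_real, Real.norm_eq_abs] at e
    calc _ = |z.1| ^ i * |z.2| ^ j * (|z.1| * ‖matCoeff φ h z‖) := by ring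
      _ ≤ |z.1| ^ i * |z.2| ^ j * (‖matCoeff (mulVar φ) h z‖ + ‖matCoeff φ (mulVar h) z‖) := by
        gcongr
        exact e.le.trans (norm_sub_le _ _)
      _ ≤ _ := by
        rw [mul_add]
        exact add_le_add (hC z) (hC' z)

theorem exists_pow_norm_mul_matCoeff_le (m : ℕ) (φ h : 𝓢(ℝ, ℂ)) :
    ∃ C, ∀ z, ‖z‖ ^ m * ‖matCoeff φ h z‖ ≤ C := by
  obtain ⟨C, hC⟩ := exists_bound_matCoeff m 0 φ h
  obtain ⟨C', hC'⟩ := exists_bound_matCoeff 0 m φ h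
  refine ⟨max C C', fun z => ?_⟩
  rw [Prod.norm_def, Real.norm_eq_abs, Real.norm_eq_abs]
  rcases le_total |z.1| |z.2| with hz | hz
  · rw [max_eq_right hz]
    exact (by simpa using hC' z : _ ≤ C').trans (le_max_right _ _)
  · rw [max_eq_left hz]
    exact (by simpa using hC z : _ ≤ C).trans (le_max_left _ _)

theorem integrable_one_add_norm_pow_mul_matCoeff (m : ℕ) (φ h : 𝓢(ℝ, ℂ)) :
    Integrable (fun z => (1 + ‖z‖) ^ m * ‖matCoeff φ h z‖) := by
  have h1 : ∀ k, Integrable (fun z => ‖z‖ ^ k * ‖matCoeff φ h z‖) := fun k => by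
    obtain ⟨C, hC⟩ := exists_pow_norm_mul_matCoeff_le 0 φ h
    obtain ⟨C', hC'⟩ := exists_pow_norm_mul_matCoeff_le
      (k + (volume : Measure (ℝ × ℝ)).integrablePower) φ h
    exact integrable_of_le_of_pow_mul_le (fun z => by simpa using hC z) hC'
      (continuous_matCoeff φ h).aestronglyMeasurable
  have h2 : (fun z => (1 + ‖z‖) ^ m * ‖matCoeff φ h z‖)
      = fun z => ∑ k ∈ Finset.range (m + 1), (m.choose k : ℝ) * (‖z‖ ^ k * ‖matCoeff φ h z‖) := by
    ext z
    rw [add_comm, add_pow, Finset.sum_mul]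
    refine Finset.sum_congr rfl fun k _ => ?_
    simp only [one_pow]
    ring
  rw [h2]
  exact integrable_finsetSum _ fun k _ => (h1 k).const_mul _

theorem integrable_matCoeff (φ h : 𝓢(ℝ, ℂ)) : Integrable (matCoeff φ h) := by
  have := integrable_one_add_norm_pow_mul_matCoeff 0 φ h
  simp only [pow_zero, one_mul] at this
  exact (integrable_norm_iff (continuous_matCoeff φ h).aestronglyMeasurable).1 this

/-! ### Area preserving linear maps of the time-frequency plane -/

theorem measurePreserving_of_abs_det_eq_one {a b c d : ℝ} (h : |a * d - b * c| = 1) :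
    MeasurePreserving (fun z : ℝ × ℝ => (a * z.1 + b * z.2, c * z.1 + d * z.2)) := by
  set L : ℝ × ℝ →ₗ[ℝ] ℝ × ℝ :=
    Matrix.toLin (Module.Basis.finTwoProd ℝ) (Module.Basis.finTwoProd ℝ) !![a, b; c, d] with hL
  have hdet : LinearMap.det L = a * d - b * c := by
    rw [hL, LinearMap.det_toLin, Matrix.det_fin_two_of]
  have hcoe : (fun z : ℝ × ℝ => (a * z.1 + b * z.2, c * z.1 + d * z.2)) = L := by
    ext z <;> simp [hL, Matrix.toLin_finTwoProd_apply]
  rw [hcoe]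
  refine ⟨by rw [← hcoe]; fun_prop, ?_⟩
  have hne : LinearMap.det L ≠ 0 := fun h0 => by
    rw [← hdet, h0] at h
    simp at h
  rw [Measure.map_linearMap_addHaar_eq_smul_addHaar volume hne, hdet, abs_inv, h]
  simp

theorem measurePreserving_fst_neg_snd :
    MeasurePreserving (fun z : ℝ × ℝ => (z.1, -z.2)) := by
  simpa using measurePreserving_of_abs_det_eq_one (a := 1) (b := 0) (c := 0) (d := -1) (by simp)

theorem norm_fst_neg_snd (z : ℝ × ℝ) : ‖(z.1, -z.2)‖ = ‖z‖ := by
  simp [Prod.norm_def]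

/-! ### The reproducing formula -/

/-- For fixed `x`, the coefficient at `-ω` is the inverse Fourier transform of `φ · h(· - x)`, so
this is Fourier inversion. -/
theorem integral_matCoeff_mul_charFn (φ h : 𝓢(ℝ, ℂ)) (x t : ℝ) :
    ∫ ω, matCoeff φ h (x, -ω) * charFn ω t = φ t * h (t - x) := by
  set u : 𝓢(ℝ, ℂ) := SchwartzMap.pairing (ContinuousLinearMap.mul ℂ ℂ) φ
    (SchwartzMap.compSubConstCLM ℝ x h) with hu
  have hu' : ∀ s, u s = φ s * h (s - x) := fun s => by simp [hu, SchwartzMap.pairing_apply_apply]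
  have h1 : ∀ ω, matCoeff φ h (x, -ω) = 𝓕⁻ u ω := fun ω => by
    rw [SchwartzMap.fourierInv_coe, Real.fourierInv_eq', matCoeff]
    refine integral_congr_ae (Filter.Eventually.of_forall fun s => ?_)
    simp only [tfShift_apply, hu', charFn, smul_eq_mul]
    rw [show -(2 * Real.pi * I * ((-ω : ℝ) : ℂ) * (s : ℂ))
      = ((2 * Real.pi * inner ℝ s ω : ℝ) : ℂ) * I by simp; ring]
    ring
  rw [← hu' t]
  conv_rhs => rw [← FourierTransform.fourier_fourierInv_eq (F := 𝓢(ℝ, ℂ)) u]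
  rw [SchwartzMap.fourier_coe, Real.fourier_eq']
  refine integral_congr_ae (Filter.Eventually.of_forall fun ω => ?_)
  simp only [h1, charFn, smul_eq_mul]
  rw [show -(2 * Real.pi * I * (ω : ℂ) * (t : ℂ))
      = ((-2 * Real.pi * inner ℝ ω t : ℝ) : ℂ) * I by simp; ring]
  ring

theorem integrable_weightedDeriv_matCoeff_smul_tfShift (φ g h : 𝓢(ℝ, ℂ)) (k n : ℕ) :
    Integrable fun z : ℝ × ℝ => weightedDeriv k n (matCoeff φ g (z.1, -z.2) • tfShift h z) := by
  obtain ⟨hc, C, m, hC⟩ := isModerate_weightedDeriv k n h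
  simp only [map_smul]
  have h1 := ((measurePreserving_fst_neg_snd.integrable_comp
    ((integrable_one_add_norm_pow_mul_matCoeff m φ g).aestronglyMeasurable)).2
      (integrable_one_add_norm_pow_mul_matCoeff m φ g)).const_mul C
  refine h1.mono' (Continuous.aestronglyMeasurable ?_) (Filter.Eventually.of_forall fun z => ?_)
  · exact ((continuous_matCoeff φ g).comp (by fun_prop)).smul hc
  · rw [norm_smul]
    simp only [Function.comp_apply, norm_fst_neg_snd]
    calc _ ≤ ‖matCoeff φ g (z.1, -z.2)‖ * (C * (1 + ‖z‖) ^ m) := by gcongr; exact hC z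
      _ = _ := by ring

theorem integral_matCoeff_smul_tfShift (φ g h : 𝓢(ℝ, ℂ)) (t : ℝ) :
    ∫ z : ℝ × ℝ, (matCoeff φ g (z.1, -z.2) • tfShift h z) t = (∫ s, g s * h s) * φ t := by
  have h1 := integrable_eval_of_integrable_weightedDeriv
    (integrable_weightedDeriv_matCoeff_smul_tfShift φ g h) 0 t
  simp only [pow_zero, one_apply_eq_self] at h1
  rw [Measure.volume_eq_prod] at h1 ⊢
  rw [integral_prod _ h1]
  have h2 : ∀ x, ∫ ω, (matCoeff φ g (x, -ω) • tfShift h (x, ω)) t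
      = φ t * (g (t - x) * h (t - x)) := fun x => by
    rw [← mul_assoc, ← integral_matCoeff_mul_charFn, ← integral_mul_const]
    refine integral_congr_ae (Filter.Eventually.of_forall fun ω => ?_)
    simp
    ring
  simp only [h2]
  rw [integral_const_mul, integral_sub_left_eq_self (fun s => g s * h s), mul_comm]

theorem integral_mul_temperedDistribution (f : 𝓢'(ℝ, ℂ)) (φ g h : 𝓢(ℝ, ℂ)) :
    ∫ z : ℝ × ℝ, matCoeff φ g (z.1, -z.2) * f (tfShift h z) = (∫ s, g s * h s) * f φ := by
  have h1 := temperedDistribution_apply_eq_integral f (ψ := (∫ s, g s * h s) • φ)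
    (integrable_weightedDeriv_matCoeff_smul_tfShift φ g h)
    (fun t => (integral_matCoeff_smul_tfShift φ g h t).symm)
  simp only [map_smul, smul_eq_mul] at h1
  exact h1.symm

theorem integral_conjSchwartz_mul_ne_zero {h : 𝓢(ℝ, ℂ)} (hh : h ≠ 0) :
    ∫ s, conjSchwartz h s * h s ≠ 0 := by
  have h1 : (fun s => conjSchwartz h s * h s) = fun s => ((‖h s‖ ^ 2 : ℝ) : ℂ) := by
    ext s
    rw [conjSchwartz_apply, mul_comm, Complex.mul_conj, Complex.normSq_eq_norm_sq]
  have h2 : Integrable fun s => ‖h s‖ ^ 2 := by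
    have := (integrable_mul_schwartz (conjSchwartz h) h).norm
    refine this.congr (Filter.Eventually.of_forall fun s => ?_)
    simp [sq]
  have hcont : Continuous fun s => ‖h s‖ ^ 2 := h.continuous.norm.pow 2
  rw [h1, integral_complex_ofReal, Complex.ofReal_ne_zero]
  intro h0
  rw [integral_eq_zero_iff_of_nonneg (fun s => by positivity) h2,
    hcont.ae_eq_iff_eq volume continuous_zero] at h0
  refine hh (SchwartzMap.ext fun s => ?_)
  simpa using congrFun h0 s

/-! ### Change of window -/

/-- Covariance: substituting `t + w.1` for `t` turns the shift of the function into a translation of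
the coefficient, up to a phase. -/
theorem norm_matCoeff_tfShift (h₂ g : 𝓢(ℝ, ℂ)) (w z : ℝ × ℝ) :
    ‖matCoeff (tfShift h₂ w) g (z.1, -z.2)‖ = ‖matCoeff h₂ g (z.1 - w.1, -(z.2 - w.2))‖ := by
  have h1 : matCoeff (tfShift h₂ w) g (z.1, -z.2)
      = charFn (w.2 - z.2) w.1 * matCoeff h₂ g (z.1 - w.1, -(z.2 - w.2)) := by
    simp only [matCoeff]
    rw [← integral_const_mul, ← integral_add_right_eq_self _ w.1]
    refine integral_congr_ae (Filter.Eventually.of_forall fun t => ?_)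
    simp only [tfShift_apply, charFn]
    rw [show t + w.1 - w.1 = t by ring, show t + w.1 - z.1 = t - (z.1 - w.1) by ring]
    have e : cexp (-(2 * Real.pi * I * (w.2 : ℂ) * ((t + w.1 : ℝ) : ℂ)))
        * cexp (-(2 * Real.pi * I * ((-z.2 : ℝ) : ℂ) * ((t + w.1 : ℝ) : ℂ)))
        = cexp (-(2 * Real.pi * I * ((w.2 - z.2 : ℝ) : ℂ) * (w.1 : ℂ)))
        * cexp (-(2 * Real.pi * I * ((-(z.2 - w.2) : ℝ) : ℂ) * (t : ℂ))) := by
      rw [← Complex.exp_add, ← Complex.exp_add]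
      congr 1
      push_cast
      ring
    linear_combination (h₂ t * g (t - (z.1 - w.1))) * e
  rw [h1, norm_mul, norm_charFn, one_mul]

theorem exists_window_change {h : 𝓢(ℝ, ℂ)} (hh : h ≠ 0) (h₂ : 𝓢(ℝ, ℂ)) :
    ∃ C : ℝ, ∀ f : 𝓢'(ℝ, ℂ), Integrable (fun z => f (tfShift h z)) →
      Integrable (fun z => f (tfShift h₂ z)) ∧
      ∫ z, ‖f (tfShift h₂ z)‖ ≤ C * ∫ z, ‖f (tfShift h z)‖ := by
  set g := conjSchwartz h
  set c := ∫ s, g s * h s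
  have hc : c ≠ 0 := integral_conjSchwartz_mul_ne_zero hh
  -- The signs are such that `k (w - z)` is the modulus given by `norm_matCoeff_tfShift`.
  set k : ℝ × ℝ → ℝ := fun z => ‖matCoeff h₂ g (-z.1, z.2)‖ with hk
  have hki : Integrable k := by
    have h1 : MeasurePreserving (fun z : ℝ × ℝ => (-z.1, z.2)) := by
      simpa using measurePreserving_of_abs_det_eq_one (a := -1) (b := 0) (c := 0) (d := 1) (by simp)
    exact ((h1.integrable_comp (integrable_matCoeff h₂ g).aestronglyMeasurable).2
      (integrable_matCoeff h₂ g)).norm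
  refine ⟨‖c‖⁻¹ * ∫ z, k z, fun f hf => ?_⟩
  set Fn : ℝ × ℝ → ℝ := fun z => ‖f (tfShift h z)‖
  have hFn : Integrable Fn := hf.norm
  set G : ℝ × ℝ → ℝ := fun w => ‖c‖⁻¹ * convolution Fn k (ContinuousLinearMap.mul ℝ ℝ) volume w
  have hG : Integrable G := (hFn.integrable_convolution _ hki).const_mul _
  have hex := hFn.ae_convolution_exists (ContinuousLinearMap.mul ℝ ℝ) hki
  have hle : ∀ᵐ w, ‖f (tfShift h₂ w)‖ ≤ G w := by
    filter_upwards [hex] with w hw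
    have e := integral_mul_temperedDistribution f (tfShift h₂ w) g h
    have e2 : ‖c‖ * ‖f (tfShift h₂ w)‖ ≤ convolution Fn k (ContinuousLinearMap.mul ℝ ℝ) volume w := by
      rw [← norm_mul, ← e]
      refine norm_integral_le_of_norm_le hw (Filter.Eventually.of_forall fun z => ?_)
      rw [norm_mul, norm_matCoeff_tfShift]
      simp only [ContinuousLinearMap.mul_apply', hk, Fn]
      rw [mul_comm]
      simp
    rwa [← inv_mul_le_iff₀ (inv_pos.2 (norm_pos_iff.2 hc)), inv_inv]
  have hint : Integrable fun z => f (tfShift h₂ z) :=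
    hG.mono' (f.continuous.comp (continuous_tfShift h₂)).aestronglyMeasurable hle
  refine ⟨hint, (integral_mono_ae hint.norm hG hle).trans (le_of_eq ?_)⟩
  simp only [G]
  rw [integral_const_mul, integral_convolution _ hFn hki]
  simp only [ContinuousLinearMap.mul_apply']
  ring

/-! ### The bilinear pairing on `L²` -/

/-- The bilinear pairing `∫ u v` of square integrable functions. -/
noncomputable def l2Pairing : L2R →L[ℂ] L2R →L[ℂ] ℂ :=
  (ContinuousLinearMap.mul ℂ ℂ).lpPairing volume 2 2

theorem l2Pairing_apply (u v : L2R) : l2Pairing u v = ∫ t, u t * v t := by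
  simp [l2Pairing, ContinuousLinearMap.lpPairing_eq_integral]

theorem l2Pairing_comm (u v : L2R) : l2Pairing u v = l2Pairing v u := by
  simp only [l2Pairing_apply, mul_comm]

theorem dualEmbedding_eq_l2Pairing {B : Type*} [SeminormedAddCommGroup B] [NormedSpace ℂ B]
    (j : B →L[ℂ] L2R) (h : L2R) (f : B) : dualEmbedding j h f = l2Pairing h (j f) := rfl

theorem l2Pairing_toLp (u : L2R) (φ : 𝓢(ℝ, ℂ)) :
    l2Pairing u (φ.toLp 2) = Lp.toTemperedDistribution u φ := by
  rw [l2Pairing_apply, Lp.toTemperedDistribution_apply]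
  refine integral_congr_ae ?_
  filter_upwards [φ.coeFn_toLp 2] with t ht
  rw [ht, smul_eq_mul, mul_comm]

theorem l2Pairing_toLp_toLp (φ ψ : 𝓢(ℝ, ℂ)) :
    l2Pairing (φ.toLp 2) (ψ.toLp 2) = ∫ t, φ t * ψ t := by
  rw [l2Pairing_apply]
  refine integral_congr_ae ?_
  filter_upwards [φ.coeFn_toLp 2, ψ.coeFn_toLp 2] with t h1 h2
  rw [h1, h2]

theorem toTemperedDistribution_injective :
    Function.Injective (Lp.toTemperedDistribution : L2R → 𝓢'(ℝ, ℂ)) :=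
  LinearMap.ker_eq_bot.1 (Lp.ker_toTemperedDistributionCLM_eq_bot (F := ℂ) (E := ℝ) (p := 2))

theorem toTemperedDistribution_zero : Lp.toTemperedDistribution (0 : L2R) = 0 :=
  map_zero (Lp.toTemperedDistributionCLM ℂ (volume : Measure ℝ) 2)

theorem toTemperedDistribution_add (u v : L2R) : Lp.toTemperedDistribution (u + v)
    = Lp.toTemperedDistribution u + Lp.toTemperedDistribution v :=
  map_add (Lp.toTemperedDistributionCLM ℂ (volume : Measure ℝ) 2) u v

theorem toTemperedDistribution_smul (c : ℂ) (u : L2R) :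
    Lp.toTemperedDistribution (c • u) = c • Lp.toTemperedDistribution u :=
  map_smul (Lp.toTemperedDistributionCLM ℂ (volume : Measure ℝ) 2) c u

theorem norm_toLp_tfShift (h : 𝓢(ℝ, ℂ)) (z : ℝ × ℝ) :
    ‖(tfShift h z).toLp 2‖ = ‖h.toLp 2‖ := by
  rw [SchwartzMap.norm_toLp, SchwartzMap.norm_toLp]
  congr 1
  rw [← eLpNorm_comp_measurePreserving h.continuous.aestronglyMeasurable
    (measurePreserving_sub_right volume z.1)]
  exact eLpNorm_congr_norm_ae (Filter.Eventually.of_forall fun t => by simp [norm_charFn])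

theorem integrable_smul_toLp_tfShift (h : 𝓢(ℝ, ℂ)) {F : ℝ × ℝ → ℂ} (hF : Integrable F) :
    Integrable fun z : ℝ × ℝ => F z • (tfShift h (z.1, -z.2)).toLp 2 := by
  refine (hF.norm.mul_const ‖h.toLp 2‖).mono' ?_ (Filter.Eventually.of_forall fun z => ?_)
  · refine hF.aestronglyMeasurable.smul (Continuous.aestronglyMeasurable ?_)
    exact SchwartzMap.continuous_toLp.comp ((continuous_tfShift h).comp (by fun_prop))
  · rw [norm_smul, norm_toLp_tfShift]

theorem toTemperedDistribution_integral (h : 𝓢(ℝ, ℂ)) {F : ℝ × ℝ → ℂ} (hF : Integrable F)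
    (φ : 𝓢(ℝ, ℂ)) :
    Lp.toTemperedDistribution (∫ z : ℝ × ℝ, F z • (tfShift h (z.1, -z.2)).toLp 2) φ
      = ∫ z : ℝ × ℝ, matCoeff φ h (z.1, -z.2) * F z := by
  rw [← l2Pairing_toLp, l2Pairing_comm, ← ContinuousLinearMap.integral_comp_comm _
    (integrable_smul_toLp_tfShift h hF)]
  refine integral_congr_ae (Filter.Eventually.of_forall fun z => ?_)
  simp only [map_smul, smul_eq_mul, l2Pairing_toLp_toLp]
  rw [mul_comm]
  rfl

/-! ### The Banach Gelfand triple -/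

/-- A point off the closure is separated from it by a continuous functional, and for the weak
topology such a functional is pairing with some `f`. -/
theorem WeakBilin.dense_of_annihilator {E F : Type*} [AddCommGroup E] [Module ℂ E]
    [AddCommGroup F] [Module ℂ F] (B : E →ₗ[ℂ] F →ₗ[ℂ] ℂ) (S : Submodule ℂ (WeakBilin B))
    (hS : ∀ f : F, (∀ e ∈ S, B e f = 0) → ∀ e, B e f = 0) :
    Dense (S : Set (WeakBilin B)) := by
  intro x
  by_contra hx
  have hxS : x ∉ (S.topologicalClosure : Set (WeakBilin B)) := hx
  obtain ⟨φ, u, hφx, hφ⟩ := RCLike.geometric_hahn_banach_point_closed (𝕜 := ℂ)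
    ((S.topologicalClosure.restrictScalars ℝ).convex) S.isClosed_topologicalClosure hxS
  have hu : u < 0 := by simpa using hφ 0 (zero_mem _)
  have hvan : ∀ b ∈ S, φ b = 0 := fun b hb => by
    -- A suitable multiple of `b` would give `φ` exactly the value `u`, which strict separation
    -- excludes.
    by_contra hne
    have h1 := hφ ((u / φ b) • b) (Submodule.smul_mem _ _ (S.le_topologicalClosure hb))
    rw [map_smul, smul_eq_mul, div_mul_cancel₀ _ hne] at h1
    simp at h1
  obtain ⟨f, rfl⟩ := LinearMap.dualEmbedding_surjective (B := B) φ
  have h0 : B x f = 0 := hS f hvan x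
  change RCLike.re (B x f) < u at hφx
  rw [h0, map_zero] at hφx
  exact hφx.not_gt hu

theorem denseRange_toWeakDual {B H : Type*} [SeminormedAddCommGroup B] [NormedSpace ℂ B]
    [NormedAddCommGroup H] [NormedSpace ℂ H] (i : H →L[ℂ] StrongDual ℂ B)
    (hi : ∀ f : B, (∀ h, i h f = 0) → ∀ u : StrongDual ℂ B, u f = 0) :
    DenseRange fun h : H => StrongDual.toWeakDual (i h) := by
  have h1 := WeakBilin.dense_of_annihilator (topDualPairing ℂ B)
    (LinearMap.range i.toLinearMap) fun f hf u =>
      hi f (fun h => hf _ (LinearMap.mem_range_self _ h)) u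
  exact h1

namespace S0

variable {g : 𝓢(ℝ, ℂ)}

theorem toDistribution_injective : Function.Injective (toDistribution (g := g)) :=
  Subtype.val_injective

theorem stft_sub (u v : 𝓢'(ℝ, ℂ)) (z : ℝ × ℝ) : stft g (u - v) z = stft g u z - stft g v z := rfl

theorem continuous_stft (f : 𝓢'(ℝ, ℂ)) : Continuous (stft g f) :=
  f.continuous.comp (continuous_tfShift _)

/-- The element of `S₀(ℝ)` given by a tempered distribution with integrable `V_g f`. -/
def mk (f : 𝓢'(ℝ, ℂ)) (hf : Integrable (stft g f)) : S0 g := (⟨f, hf⟩ : S0Submodule g)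

@[simp]
theorem toDistribution_mk (f : 𝓢'(ℝ, ℂ)) (hf : Integrable (stft g f)) :
    toDistribution (mk f hf) = f := rfl

theorem eLpNorm_stft (f : S0 g) : eLpNorm (stft g (toDistribution f)) 1 volume = ENNReal.ofReal ‖f‖ := by
  rw [eLpNorm_one_eq_lintegral_enorm, norm_def, ofReal_integral_norm_eq_lintegral_enorm
    (integrable_stft f)]

/-- The constant `∫ |g|²` of the reproducing formula. -/
noncomputable def windowConst (g : 𝓢(ℝ, ℂ)) : ℂ := ∫ s, g s * conjSchwartz g s

theorem windowConst_ne_zero (hg : g ≠ 0) : windowConst g ≠ 0 := by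
  have := integral_conjSchwartz_mul_ne_zero hg
  simpa only [windowConst, mul_comm] using this

theorem toTemperedDistribution_synthesis (hg : g ≠ 0) (f : S0 g) :
    Lp.toTemperedDistribution ((windowConst g)⁻¹ •
      ∫ z : ℝ × ℝ, stft g (toDistribution f) z • (tfShift g (z.1, -z.2)).toLp 2)
      = toDistribution f := by
  ext φ
  rw [toTemperedDistribution_smul]
  change (windowConst g)⁻¹ • Lp.toTemperedDistribution (_ : L2R) φ = _
  rw [toTemperedDistribution_integral g (integrable_stft f)]
  have := integral_mul_temperedDistribution (toDistribution f) φ g (conjSchwartz g)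
  simp only [stft_eq, this]
  exact inv_mul_cancel_left₀ (windowConst_ne_zero hg) _

/-- The embedding of `S₀(ℝ)` into `L²(ℝ)`. -/
noncomputable def toL2 (hg : g ≠ 0) : S0 g →L[ℂ] L2R :=
  LinearMap.mkContinuous
    { toFun := fun f => (windowConst g)⁻¹ •
        ∫ z : ℝ × ℝ, stft g (toDistribution f) z • (tfShift g (z.1, -z.2)).toLp 2
      -- Linearity is read off in the tempered distributions, where the synthesis integral is just
      -- `f`.
      map_add' := fun u v => by
        apply toTemperedDistribution_injective
        rw [toTemperedDistribution_synthesis hg, toTemperedDistribution_add,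
          toTemperedDistribution_synthesis hg, toTemperedDistribution_synthesis hg, map_add]
      map_smul' := fun c u => by
        apply toTemperedDistribution_injective
        rw [RingHom.id_apply, toTemperedDistribution_synthesis hg, toTemperedDistribution_smul,
          toTemperedDistribution_synthesis hg, map_smul] }
    (‖(windowConst g)⁻¹‖ * ‖g.toLp 2‖) fun f => by
      simp only [LinearMap.coe_mk, AddHom.coe_mk]
      rw [norm_smul, mul_assoc]
      gcongr
      refine (norm_integral_le_of_norm_le ((integrable_stft f).norm.mul_const ‖g.toLp 2‖)
        (Filter.Eventually.of_forall fun z => ?_)).trans (le_of_eq ?_)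
      · rw [norm_smul, norm_toLp_tfShift]
      · rw [integral_mul_const, norm_def, mul_comm]

theorem toTemperedDistribution_toL2 (hg : g ≠ 0) (f : S0 g) :
    Lp.toTemperedDistribution (toL2 hg f) = toDistribution f :=
  toTemperedDistribution_synthesis hg f

theorem toL2_injective (hg : g ≠ 0) : Function.Injective (toL2 hg) := fun u v h => by
  apply toDistribution_injective
  rw [← toTemperedDistribution_toL2 hg, h, toTemperedDistribution_toL2]

/-- A Schwartz function as an element of `S₀(ℝ)`. -/
noncomputable def ofSchwartz (g φ : 𝓢(ℝ, ℂ)) : S0 g :=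
  mk (Lp.toTemperedDistribution (φ.toLp 2 : L2R)) <|
    (integrable_matCoeff φ (conjSchwartz g)).congr <| Filter.Eventually.of_forall fun z => by
      rw [stft_eq, ← l2Pairing_toLp, l2Pairing_toLp_toLp]
      rfl

theorem toL2_ofSchwartz (hg : g ≠ 0) (φ : 𝓢(ℝ, ℂ)) : toL2 hg (ofSchwartz g φ) = φ.toLp 2 :=
  toTemperedDistribution_injective (toTemperedDistribution_toL2 hg _)

theorem denseRange_toL2 (hg : g ≠ 0) : DenseRange (toL2 hg) := by
  refine (SchwartzMap.denseRange_toLpCLM (E := ℝ) (F := ℂ) (μ := volume)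
    (p := 2) (by simp)).mono ?_
  rintro _ ⟨φ, rfl⟩
  exact ⟨ofSchwartz g φ, toL2_ofSchwartz hg φ⟩

theorem continuous_stft_toTemperedDistribution (z : ℝ × ℝ) :
    Continuous fun v : L2R => stft g (Lp.toTemperedDistribution v) z := by
  simp only [stft_eq, ← l2Pairing_toLp]
  exact (l2Pairing.flip _).continuous

/-- A Cauchy sequence converges in L², hence its transforms converge pointwise; Fatou's lemma
upgrades this to convergence in the norm of `S₀`. -/
theorem completeSpace (hg : g ≠ 0) : CompleteSpace (S0 g) := by
  refine Metric.complete_of_cauchySeq_tendsto fun u hu => ?_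
  obtain ⟨v, hv⟩ := cauchySeq_tendsto_of_complete ((toL2 hg).uniformContinuous.comp_cauchySeq hu)
  set f := Lp.toTemperedDistribution v
  have hlim : ∀ z, Filter.Tendsto (fun m => stft g (toDistribution (u m)) z) Filter.atTop
      (nhds (stft g f z)) := fun z => by
    have := ((continuous_stft_toTemperedDistribution (g := g) z).tendsto v).comp hv
    simpa [Function.comp_def, toTemperedDistribution_toL2] using this
  have hbound : ∀ ε > 0, ∃ N, ∀ n ≥ N,
      eLpNorm (stft g (toDistribution (u n) - f)) 1 volume ≤ ENNReal.ofReal ε := fun ε hε => by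
    obtain ⟨N, hN⟩ := Metric.cauchySeq_iff.1 hu ε hε
    refine ⟨N, fun n hn => ?_⟩
    refine (Lp.eLpNorm_lim_le_liminf_eLpNorm
      (f := fun m => stft g (toDistribution (u n) - toDistribution (u m)))
      (fun m => (continuous_stft _).aestronglyMeasurable) _
      (Filter.Eventually.of_forall fun z => ?_)).trans ?_
    · simp only [stft_sub]
      exact tendsto_const_nhds.sub (hlim z)
    · refine Filter.liminf_le_of_frequently_le' (Filter.Eventually.frequently ?_)
      filter_upwards [Filter.eventually_ge_atTop N] with m hm
      rw [← map_sub, eLpNorm_stft, ← dist_eq_norm]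
      exact ENNReal.ofReal_le_ofReal (hN n hn m hm).le
  have hint : Integrable (stft g f) := by
    obtain ⟨N, hN⟩ := hbound 1 one_pos
    have h1 : Integrable (stft g (toDistribution (u N) - f)) := by
      rw [← memLp_one_iff_integrable]
      exact ⟨(continuous_stft _).aestronglyMeasurable,
        (hN N le_rfl).trans_lt ENNReal.ofReal_lt_top⟩
    refine ((integrable_stft (u N)).sub h1).congr (Filter.Eventually.of_forall fun z => ?_)
    simp [stft_sub]
  refine ⟨mk f hint, Metric.tendsto_atTop.2 fun ε hε => ?_⟩
  obtain ⟨N, hN⟩ := hbound (ε / 2) (half_pos hε)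
  refine ⟨N, fun n hn => ?_⟩
  have h1 := hN n hn
  rw [← toDistribution_mk f hint, ← map_sub, eLpNorm_stft,
    ENNReal.ofReal_le_ofReal_iff (half_pos hε).le] at h1
  rw [dist_eq_norm]
  linarith

theorem isBanachGelfandTriple (hg : g ≠ 0) :
    IsBanachGelfandTriple (toL2 hg) (dualEmbedding (toL2 hg)) where
  norm_definite f hf := by
    apply toL2_injective hg
    rw [map_zero, ← norm_le_zero_iff]
    exact ((toL2 hg).le_opNorm f).trans (by rw [hf, mul_zero])
  complete := completeSpace hg
  complete_hilbert := inferInstance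
  injective := toL2_injective hg
  denseRange := denseRange_toL2 hg
  dual_injective := by
    rw [injective_iff_map_eq_zero]
    intro h hh
    apply toTemperedDistribution_injective
    ext φ
    have h1 : dualEmbedding (toL2 hg) h (ofSchwartz g φ) = 0 := by
      rw [hh]
      rfl
    rw [dualEmbedding_eq_l2Pairing, toL2_ofSchwartz, l2Pairing_toLp] at h1
    rw [h1, toTemperedDistribution_zero]
    rfl
  dual_continuous :=
    NormedSpace.Dual.toWeakDual_continuous.comp (dualEmbedding (toL2 hg)).continuous
  dual_denseRange := by
    refine denseRange_toWeakDual _ fun f hf u => ?_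
    have h1 : f = 0 := by
      apply toL2_injective hg
      apply toTemperedDistribution_injective
      ext φ
      have h2 := hf (φ.toLp 2)
      rw [dualEmbedding_eq_l2Pairing, l2Pairing_comm, l2Pairing_toLp] at h2
      rw [h2, map_zero, toTemperedDistribution_zero]
      rfl
    rw [h1, map_zero]

end S0

/-! ### Operators that permute time-frequency shifts -/

/-- A map on `L²(ℝ)` that sends the time-frequency shifts of a Schwartz function, up to unimodular
factors, to those of another Schwartz function, with a measure preserving change of the shift. -/
def PermutesTFShifts (U : L2R → L2R) : Prop :=
  ∀ h : 𝓢(ℝ, ℂ), ∃ (h₂ : 𝓢(ℝ, ℂ)) (A : ℝ × ℝ → ℝ × ℝ), MeasurePreserving A ∧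
    ∀ z, ∃ θ : ℂ, ‖θ‖ = 1 ∧ U ((tfShift h z).toLp 2) = θ • (tfShift h₂ (A z)).toLp 2 volume

theorem PermutesTFShifts.comp {U V : L2R ≃ₗᵢ[ℂ] L2R} (hU : PermutesTFShifts U)
    (hV : PermutesTFShifts V) : PermutesTFShifts (V.trans U) := by
  intro h
  obtain ⟨h₁, A, hA, h1⟩ := hV h
  obtain ⟨h₂, A', hA', h2⟩ := hU h₁
  refine ⟨h₂, A' ∘ A, hA'.comp hA, fun z => ?_⟩
  obtain ⟨θ, hθ, e⟩ := h1 z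
  obtain ⟨θ', hθ', e'⟩ := h2 (A z)
  refine ⟨θ * θ', by rw [norm_mul, hθ, hθ', one_mul], ?_⟩
  rw [LinearIsometryEquiv.trans_apply, e, map_smul, e', smul_smul]
  rfl

/-- `Tt` is the transpose of `T` for the bilinear pairing on `L²(ℝ)`, and both operators and their
inverses permute the time-frequency shifts. -/
structure IsMetaplecticPair (T Tt : L2R ≃ₗᵢ[ℂ] L2R) : Prop where
  pairing : ∀ u v, l2Pairing (T u) v = l2Pairing u (Tt v)
  permutes : PermutesTFShifts T
  permutes_symm : PermutesTFShifts T.symm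
  permutes_transpose : PermutesTFShifts Tt
  permutes_transpose_symm : PermutesTFShifts Tt.symm

namespace IsMetaplecticPair

variable {T Tt S St : L2R ≃ₗᵢ[ℂ] L2R}

theorem transpose (h : IsMetaplecticPair T Tt) : IsMetaplecticPair Tt T where
  pairing u v := by rw [l2Pairing_comm, ← h.pairing, l2Pairing_comm]
  permutes := h.permutes_transpose
  permutes_symm := h.permutes_transpose_symm
  permutes_transpose := h.permutes
  permutes_transpose_symm := h.permutes_symm

theorem symm (h : IsMetaplecticPair T Tt) : IsMetaplecticPair T.symm Tt.symm where
  pairing u v := by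
    conv_lhs => rw [← Tt.apply_symm_apply v]
    rw [← h.pairing, T.apply_symm_apply]
  permutes := h.permutes_symm
  permutes_symm := h.permutes
  permutes_transpose := h.permutes_transpose_symm
  permutes_transpose_symm := h.permutes_transpose

theorem trans (h : IsMetaplecticPair T Tt) (h' : IsMetaplecticPair S St) :
    IsMetaplecticPair (T.trans S) (St.trans Tt) where
  pairing u v := by
    rw [LinearIsometryEquiv.trans_apply, h'.pairing, h.pairing, LinearIsometryEquiv.trans_apply]
  permutes := h'.permutes.comp h.permutes
  permutes_symm := h.permutes_symm.comp h'.permutes_symm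
  permutes_transpose := h.permutes_transpose.comp h'.permutes_transpose
  permutes_transpose_symm := h'.permutes_transpose_symm.comp h.permutes_transpose_symm

variable {g : 𝓢(ℝ, ℂ)}

/-- Moving `T` onto the window shows `|V_g (T f)(z)| = |f (tfShift h₂ (A z))|`; `A` preserves the
integral and the change of window bounds it. -/
theorem exists_bound (h : IsMetaplecticPair T Tt) (hg : g ≠ 0) :
    ∃ C, ∀ f : S0 g, ∃ f' : S0 g, S0.toL2 hg f' = T (S0.toL2 hg f) ∧ ‖f'‖ ≤ C * ‖f‖ := by
  obtain ⟨h₂, A, hA, hθ⟩ := h.permutes_transpose (conjSchwartz g)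
  have hg' : conjSchwartz g ≠ 0 := fun h0 => hg <| by
    rw [← conjSchwartz_conjSchwartz g, h0]
    ext t
    simp
  obtain ⟨C, hC⟩ := exists_window_change hg' h₂
  refine ⟨C, fun f => ?_⟩
  obtain ⟨h1, h2⟩ := hC (S0.toDistribution f) (S0.integrable_stft f)
  have hnorm : ∀ z, ‖stft g (Lp.toTemperedDistribution (T (S0.toL2 hg f))) z‖
      = ‖S0.toDistribution f (tfShift h₂ (A z))‖ := fun z => by
    obtain ⟨θ, hθ1, e⟩ := hθ z
    rw [stft_eq, ← l2Pairing_toLp, h.pairing, e, map_smul, norm_smul, hθ1, one_mul, l2Pairing_toLp,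
      S0.toTemperedDistribution_toL2]
  have h1' : Integrable (fun z => ‖S0.toDistribution f (tfShift h₂ z)‖) := h1.norm
  have hint : Integrable (stft g (Lp.toTemperedDistribution (T (S0.toL2 hg f)))) := by
    rw [← integrable_norm_iff (S0.continuous_stft _).aestronglyMeasurable]
    simp only [hnorm]
    exact (hA.integrable_comp h1'.aestronglyMeasurable).2 h1'
  refine ⟨S0.mk _ hint, toTemperedDistribution_injective (S0.toTemperedDistribution_toL2 hg _), ?_⟩
  rw [S0.norm_def]
  simp only [S0.toDistribution_mk, hnorm]
  refine le_trans (le_of_eq ?_) h2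
  have h3 := integral_map (μ := volume) hA.measurable.aemeasurable
    (f := fun z => ‖S0.toDistribution f (tfShift h₂ z)‖)
    (by rw [hA.map_eq]; exact h1'.aestronglyMeasurable)
  rw [hA.map_eq] at h3
  exact h3.symm

theorem exists_continuousLinearMap (h : IsMetaplecticPair T Tt) (hg : g ≠ 0) :
    ∃ T₀ : S0 g →L[ℂ] S0 g, ∀ f, S0.toL2 hg (T₀ f) = T (S0.toL2 hg f) := by
  obtain ⟨C, hC⟩ := h.exists_bound hg
  choose F hF hFC using hC
  refine ⟨LinearMap.mkContinuous
    { toFun := F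
      map_add' := fun u v => S0.toL2_injective hg (by simp only [hF, map_add])
      map_smul' := fun c u => S0.toL2_injective hg (by
        simp only [hF, map_smul, RingHom.id_apply]) } C hFC, hF⟩

theorem exists_continuousLinearEquiv (h : IsMetaplecticPair T Tt) (hg : g ≠ 0) :
    ∃ T₀ : S0 g ≃L[ℂ] S0 g, ∀ f, S0.toL2 hg (T₀ f) = T (S0.toL2 hg f) := by
  obtain ⟨T₀, hT₀⟩ := h.exists_continuousLinearMap hg
  obtain ⟨T₁, hT₁⟩ := h.symm.exists_continuousLinearMap hg
  refine ⟨ContinuousLinearEquiv.equivOfInverse T₀ T₁ (fun f => ?_) (fun f => ?_), hT₀⟩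
  · apply S0.toL2_injective hg
    rw [hT₁, hT₀, LinearIsometryEquiv.symm_apply_apply]
  · apply S0.toL2_injective hg
    rw [hT₀, hT₁, LinearIsometryEquiv.apply_symm_apply]

theorem isGelfandTripleAutomorphism (h : IsMetaplecticPair T Tt) (hg : g ≠ 0) :
    IsGelfandTripleAutomorphism (S0.toL2 hg) (dualEmbedding (S0.toL2 hg)) T where
  restricts := h.exists_continuousLinearEquiv hg
  unitary := ⟨T, fun _ => rfl⟩
  extends_dual := by
    obtain ⟨T₀, hT₀⟩ := h.transpose.exists_continuousLinearEquiv hg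
    -- The extension is `u ↦ u ∘ T₀`, with `T₀` the restriction of the transpose `Tt`;
    -- precomposition is weak* continuous.
    refine ⟨T₀.symm.arrowCongr (ContinuousLinearEquiv.refl ℂ ℂ), fun u => ?_, ?_, ?_⟩
    · ext f
      change dualEmbedding (S0.toL2 hg) u (T₀ f) = dualEmbedding (S0.toL2 hg) (T u) f
      rw [dualEmbedding_eq_l2Pairing, dualEmbedding_eq_l2Pairing, hT₀, h.pairing]
    · exact WeakDual.continuous_of_continuous_eval fun f => WeakDual.eval_continuous (T₀ f)
    · exact WeakDual.continuous_of_continuous_eval fun f => WeakDual.eval_continuous (T₀.symm f)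

end IsMetaplecticPair

/-! ### The Fourier transform -/

theorem fourier_tfShift (h : 𝓢(ℝ, ℂ)) (z : ℝ × ℝ) :
    𝓕 (tfShift h z) = charFn z.2 z.1 • tfShift (𝓕 h) (-z.2, z.1) := by
  ext ξ
  simp only [smul_apply, tfShift_apply, smul_eq_mul, SchwartzMap.fourier_coe, Real.fourier_eq']
  rw [← integral_const_mul, ← integral_const_mul, ← integral_add_right_eq_self _ z.1]
  refine integral_congr_ae (Filter.Eventually.of_forall fun t => ?_)
  simp only [charFn, ← mul_assoc, ← Complex.exp_add, add_sub_cancel_right]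
  congr 2
  simp
  ring

theorem fourierInv_tfShift (h : 𝓢(ℝ, ℂ)) (z : ℝ × ℝ) :
    𝓕⁻ (tfShift h z) = charFn z.2 z.1 • tfShift (𝓕⁻ h) (z.2, -z.1) := by
  ext ξ
  simp only [smul_apply, tfShift_apply, smul_eq_mul, SchwartzMap.fourierInv_coe,
    Real.fourierInv_eq']
  rw [← integral_const_mul, ← integral_const_mul, ← integral_add_right_eq_self _ z.1]
  refine integral_congr_ae (Filter.Eventually.of_forall fun t => ?_)
  simp only [charFn, ← mul_assoc, ← Complex.exp_add, add_sub_cancel_right]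
  congr 2
  simp
  ring

theorem toLp_smul (c : ℂ) (φ : 𝓢(ℝ, ℂ)) : (c • φ).toLp 2 (volume : Measure ℝ) = c • φ.toLp 2 volume :=
  map_smul (SchwartzMap.toLpCLM ℂ ℂ 2 (volume : Measure ℝ)) c φ

theorem isMetaplecticPair_fourier :
    IsMetaplecticPair (Lp.fourierTransformₗᵢ ℝ ℂ) (Lp.fourierTransformₗᵢ ℝ ℂ) := by
  have h1 : PermutesTFShifts (Lp.fourierTransformₗᵢ ℝ ℂ) := fun h => by
    refine ⟨𝓕 h, fun z => (0 * z.1 + (-1) * z.2, 1 * z.1 + 0 * z.2),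
      measurePreserving_of_abs_det_eq_one (by simp), fun z => ⟨charFn z.2 z.1, norm_charFn _ _, ?_⟩⟩
    change 𝓕 ((tfShift h z).toLp 2) = _
    rw [SchwartzMap.toLp_fourier_eq, fourier_tfShift, toLp_smul]
    simp
  have h2 : PermutesTFShifts (Lp.fourierTransformₗᵢ ℝ ℂ).symm := fun h => by
    refine ⟨𝓕⁻ h, fun z => (0 * z.1 + 1 * z.2, (-1) * z.1 + 0 * z.2),
      measurePreserving_of_abs_det_eq_one (by simp), fun z => ⟨charFn z.2 z.1, norm_charFn _ _, ?_⟩⟩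
    change 𝓕⁻ ((tfShift h z).toLp 2) = _
    rw [SchwartzMap.toLp_fourierInv_eq, fourierInv_tfShift, toLp_smul]
    simp
  refine ⟨fun u v => ?_, h1, h2, h1, h2⟩
  refine DenseRange.induction_on (p := fun v : L2R => l2Pairing (Lp.fourierTransformₗᵢ ℝ ℂ u) v
    = l2Pairing u (Lp.fourierTransformₗᵢ ℝ ℂ v))
    (SchwartzMap.denseRange_toLpCLM (E := ℝ) (F := ℂ) (p := 2) ENNReal.ofNat_ne_top) v
    (isClosed_eq (l2Pairing _).continuous
      ((l2Pairing u).continuous.comp (Lp.fourierTransformₗᵢ ℝ ℂ).continuous)) fun φ => ?_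
  change l2Pairing (𝓕 u) (φ.toLp 2) = l2Pairing u (𝓕 (φ.toLp 2))
  rw [SchwartzMap.toLp_fourier_eq, l2Pairing_toLp, l2Pairing_toLp,
    ← Lp.fourier_toTemperedDistribution_eq, TemperedDistribution.fourier_apply]

/-- Both sides have the same integrals against smooth compactly supported functions, by the
multiplication formula `∫ φ û = ∫ φ̂ u`. -/
theorem fourier_ae_eq_of_integrable (u : L2R) (hu : Integrable u volume) :
    (𝓕 u : L2R) =ᵐ[volume] 𝓕 (u : ℝ → ℂ) := by
  have hcont : Continuous (𝓕 (u : ℝ → ℂ)) :=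
    VectorFourier.fourierIntegral_continuous Real.continuous_fourierChar continuous_inner hu
  refine ae_eq_of_integral_contDiff_smul_eq
    ((Lp.memLp _).locallyIntegrable (by norm_num)) hcont.locallyIntegrable fun w hw hwc => ?_
  have hw₁ : HasCompactSupport (Complex.ofRealCLM ∘ w) := hwc.comp_left rfl
  have hw₂ : ContDiff ℝ (⊤ : ℕ∞) (Complex.ofRealCLM ∘ w) := Complex.ofRealCLM.contDiff.comp hw
  set φ : 𝓢(ℝ, ℂ) := hw₁.toSchwartzMap hw₂ with hφ
  have hφw : ∀ t, φ t = w t := fun t => rfl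
  have e1 : ∫ t, w t • (𝓕 u : L2R) t = Lp.toTemperedDistribution (𝓕 u) φ := by
    rw [Lp.toTemperedDistribution_apply]
    refine integral_congr_ae (Filter.Eventually.of_forall fun t => ?_)
    simp [hφw]
  have e2 : ∫ t, w t • 𝓕 (u : ℝ → ℂ) t = ∫ t, φ t • 𝓕 (u : ℝ → ℂ) t := by
    refine integral_congr_ae (Filter.Eventually.of_forall fun t => ?_)
    simp [hφw]
  have e3 := VectorFourier.integral_fourierIntegral_smul_eq_flip (L := innerₗ ℝ)
    Real.continuous_fourierChar continuous_inner (φ.integrable (μ := volume)) hu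
  rw [flip_innerₗ] at e3
  rw [e1, e2, ← Lp.fourier_toTemperedDistribution_eq, TemperedDistribution.fourier_apply,
    Lp.toTemperedDistribution_apply]
  exact e3

/-! ### Chirped dilations -/

/-- The chirp `κ exp(πi (α t² + 2 β t))`. -/
noncomputable def chirp (κ : ℂ) (α β : ℝ) (t : ℝ) : ℂ :=
  κ * charFn (-1 / 2) (α * t ^ 2 + 2 * β * t)

theorem chirp_eq (κ : ℂ) (α β t : ℝ) :
    chirp κ α β t = κ * cexp (Real.pi * I * (α * t ^ 2 + 2 * β * t)) := by
  rw [chirp, charFn]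
  congr 2
  push_cast
  ring

theorem norm_chirp (κ : ℂ) (α β t : ℝ) : ‖chirp κ α β t‖ = ‖κ‖ := by
  rw [chirp, norm_mul, norm_charFn, mul_one]

theorem chirp_hasTemperateGrowth (κ : ℂ) (α β : ℝ) : (chirp κ α β).HasTemperateGrowth := by
  have h1 : (fun t : ℝ => α * t ^ 2 + 2 * β * t).HasTemperateGrowth := by
    have h2 : (fun t : ℝ => t).HasTemperateGrowth := Function.HasTemperateGrowth.id'
    exact ((Function.HasTemperateGrowth.const α).mul (h2.pow 2)).add
      ((Function.HasTemperateGrowth.const (2 * β)).mul h2)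
  exact (Function.HasTemperateGrowth.const κ).mul ((charFn_hasTemperateGrowth (-1 / 2)).comp h1)

theorem continuous_chirp (κ : ℂ) (α β : ℝ) : Continuous (chirp κ α β) :=
  (chirp_hasTemperateGrowth κ α β).1.continuous

theorem quasiMeasurePreserving_mul_left {s : ℝ} (hs : s ≠ 0) :
    Measure.QuasiMeasurePreserving (fun t : ℝ => s * t) := by
  refine ⟨by fun_prop, ?_⟩
  rw [Real.map_volume_mul_left hs]
  exact Measure.smul_absolutelyContinuous

/-- Dilation by `s` scales the L² norm by `|s|^(-1/2)`, which `|κ|` cancels. -/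
theorem eLpNorm_chirp_mul_comp {s : ℝ} (hs : s ≠ 0) {κ : ℂ} (hκ : ‖κ‖ = √|s|) (α β : ℝ)
    {f : ℝ → ℂ} (hf : AEStronglyMeasurable f volume) :
    eLpNorm (fun t => chirp κ α β t * f (s * t)) 2 volume = eLpNorm f 2 volume := by
  have h1 : eLpNorm (fun t => chirp κ α β t * f (s * t)) 2 volume
      = eLpNorm (κ • fun t => f (s * t)) 2 volume :=
    eLpNorm_congr_norm_ae (Filter.Eventually.of_forall fun t => by simp [norm_chirp])
  have hmap := Real.map_volume_mul_left hs
  have h2 : eLpNorm (fun t => f (s * t)) 2 volume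
      = ENNReal.ofReal (√|s|)⁻¹ * eLpNorm f 2 volume := by
    have h3 := eLpNorm_map_measure (p := 2) (μ := volume) (g := f) (f := fun t => s * t)
      (by rw [hmap]; exact hf.smul_measure _) (by fun_prop)
    rw [Function.comp_def] at h3
    rw [← h3, hmap, eLpNorm_smul_measure_of_ne_top (by norm_num), smul_eq_mul]
    congr 1
    rw [ENNReal.ofReal_rpow_of_nonneg (abs_nonneg _) (by positivity), abs_inv,
      Real.inv_rpow (abs_nonneg _), Real.sqrt_eq_rpow]
    simp
  rw [h1, eLpNorm_const_smul, h2, ← ofReal_norm, hκ, ← mul_assoc,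
    ← ENNReal.ofReal_mul (Real.sqrt_nonneg _),
    mul_inv_cancel₀ (Real.sqrt_ne_zero'.2 (abs_pos.2 hs)), ENNReal.ofReal_one, one_mul]

theorem memLp_chirp_mul_comp {s : ℝ} (hs : s ≠ 0) {κ : ℂ} (hκ : ‖κ‖ = √|s|) (α β : ℝ) (f : L2R) :
    MemLp (fun t => chirp κ α β t * f (s * t)) 2 volume := by
  refine ⟨(continuous_chirp κ α β).aestronglyMeasurable.mul
    ((Lp.aestronglyMeasurable f).comp_quasiMeasurePreserving
      (quasiMeasurePreserving_mul_left hs)), ?_⟩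
  rw [eLpNorm_chirp_mul_comp hs hκ α β (Lp.aestronglyMeasurable f)]
  exact (Lp.memLp f).2

/-- The isometry `f ↦ κ exp(πi (α t² + 2 β t)) f(s t)` of `L²(ℝ)`. -/
noncomputable def chirpDilIsometry {s : ℝ} (hs : s ≠ 0) {κ : ℂ} (hκ : ‖κ‖ = √|s|) (α β : ℝ) :
    L2R →ₗᵢ[ℂ] L2R where
  toFun f := (memLp_chirp_mul_comp hs hκ α β f).toLp _
  map_add' u v := by
    rw [← MemLp.toLp_add]
    refine MemLp.toLp_congr _ _ ?_
    filter_upwards [(quasiMeasurePreserving_mul_left hs).ae (Lp.coeFn_add u v)] with t ht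
    rw [ht]
    simp only [Pi.add_apply, mul_add]
  map_smul' c u := by
    rw [RingHom.id_apply, ← MemLp.toLp_const_smul]
    refine MemLp.toLp_congr _ _ ?_
    filter_upwards [(quasiMeasurePreserving_mul_left hs).ae (Lp.coeFn_smul c u)] with t ht
    rw [ht]
    simp only [Pi.smul_apply, smul_eq_mul]
    ring
  norm_map' f := by
    change ‖(memLp_chirp_mul_comp hs hκ α β f).toLp _‖ = ‖f‖
    rw [Lp.norm_toLp, eLpNorm_chirp_mul_comp hs hκ α β (Lp.aestronglyMeasurable f), Lp.norm_def]

theorem coeFn_chirpDilIsometry {s : ℝ} (hs : s ≠ 0) {κ : ℂ} (hκ : ‖κ‖ = √|s|) (α β : ℝ) (f : L2R) :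
    chirpDilIsometry hs hκ α β f =ᵐ[volume] fun t => chirp κ α β t * f (s * t) :=
  MemLp.coeFn_toLp (memLp_chirp_mul_comp hs hκ α β f)

theorem chirp_inv_mul_chirp {s : ℝ} (hs : s ≠ 0) {κ : ℂ} (hκ : κ ≠ 0) (α β t : ℝ) :
    chirp κ⁻¹ (-α / s ^ 2) (-β / s) t * chirp κ α β (s⁻¹ * t) = 1 := by
  have hs' : (s : ℂ) ≠ 0 := by exact_mod_cast hs
  rw [chirp_eq, chirp_eq]
  have e : cexp (Real.pi * I * (((-α / s ^ 2 : ℝ) : ℂ) * t ^ 2 + 2 * ((-β / s : ℝ) : ℂ) * t))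
      * cexp (Real.pi * I * (α * ((s⁻¹ * t : ℝ) : ℂ) ^ 2 + 2 * β * ((s⁻¹ * t : ℝ) : ℂ))) = 1 := by
    rw [← Complex.exp_add, Complex.exp_eq_one_iff]
    refine ⟨0, ?_⟩
    push_cast
    field_simp
    ring
  calc _ = κ⁻¹ * κ * (cexp (Real.pi * I * (((-α / s ^ 2 : ℝ) : ℂ) * t ^ 2
      + 2 * ((-β / s : ℝ) : ℂ) * t))
      * cexp (Real.pi * I * (α * ((s⁻¹ * t : ℝ) : ℂ) ^ 2 + 2 * β * ((s⁻¹ * t : ℝ) : ℂ)))) := by ring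
    _ = 1 := by rw [e, mul_one, inv_mul_cancel₀ hκ]

theorem ne_zero_of_norm_eq_sqrt {s : ℝ} (hs : s ≠ 0) {κ : ℂ} (hκ : ‖κ‖ = √|s|) : κ ≠ 0 := by
  rw [← norm_pos_iff, hκ]
  exact Real.sqrt_pos.2 (abs_pos.2 hs)

theorem norm_inv_eq_sqrt {s : ℝ} {κ : ℂ} (hκ : ‖κ‖ = √|s|) : ‖κ⁻¹‖ = √|s⁻¹| := by
  rw [norm_inv, hκ, abs_inv, Real.sqrt_inv]

theorem chirpDilIsometry_inv {s r : ℝ} (hs : s ≠ 0) (hr : r ≠ 0) {κ η : ℂ} (hκ : ‖κ‖ = √|s|)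
    (hη : ‖η‖ = √|r|) (α β γ δ : ℝ) (hrs : s * r = 1)
    (h : ∀ t, chirp η γ δ t * chirp κ α β (r * t) = 1) (f : L2R) :
    chirpDilIsometry hr hη γ δ (chirpDilIsometry hs hκ α β f) = f := by
  apply Lp.ext
  filter_upwards [coeFn_chirpDilIsometry hr hη γ δ (chirpDilIsometry hs hκ α β f),
    (quasiMeasurePreserving_mul_left hr).ae (coeFn_chirpDilIsometry hs hκ α β f)] with t h1 h2
  rw [h1, h2, ← mul_assoc, h, one_mul, ← mul_assoc, hrs, one_mul]

/-- The unitary operator `f ↦ κ exp(πi (α t² + 2 β t)) f(s t)` of `L²(ℝ)`. -/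
noncomputable def chirpDil {s : ℝ} (hs : s ≠ 0) {κ : ℂ} (hκ : ‖κ‖ = √|s|) (α β : ℝ) :
    L2R ≃ₗᵢ[ℂ] L2R :=
  LinearIsometryEquiv.ofSurjective (chirpDilIsometry hs hκ α β) fun f =>
    ⟨chirpDilIsometry (inv_ne_zero hs) (norm_inv_eq_sqrt hκ) (-α / s ^ 2) (-β / s) f,
      chirpDilIsometry_inv (inv_ne_zero hs) hs (norm_inv_eq_sqrt hκ) hκ _ _ _ _
        (inv_mul_cancel₀ hs) (fun t => by
          have h1 := chirp_inv_mul_chirp hs (ne_zero_of_norm_eq_sqrt hs hκ) α β (s * t)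
          rwa [inv_mul_cancel_left₀ hs, mul_comm] at h1) f⟩

theorem coeFn_chirpDil {s : ℝ} (hs : s ≠ 0) {κ : ℂ} (hκ : ‖κ‖ = √|s|) (α β : ℝ) (f : L2R) :
    chirpDil hs hκ α β f =ᵐ[volume] fun t => chirp κ α β t * f (s * t) :=
  coeFn_chirpDilIsometry hs hκ α β f

theorem chirpDil_symm {s : ℝ} (hs : s ≠ 0) {κ : ℂ} (hκ : ‖κ‖ = √|s|) (α β : ℝ) :
    (chirpDil hs hκ α β).symm
      = chirpDil (inv_ne_zero hs) (norm_inv_eq_sqrt hκ) (-α / s ^ 2) (-β / s) := by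
  ext1 f
  obtain ⟨u, rfl⟩ := (chirpDil hs hκ α β).surjective f
  rw [LinearIsometryEquiv.symm_apply_apply]
  exact (chirpDilIsometry_inv hs (inv_ne_zero hs) hκ (norm_inv_eq_sqrt hκ) _ _ _ _
    (mul_inv_cancel₀ hs) (chirp_inv_mul_chirp hs (ne_zero_of_norm_eq_sqrt hs hκ) α β) u).symm

theorem norm_transpose_eq_sqrt {s : ℝ} (hs : s ≠ 0) {κ : ℂ} (hκ : ‖κ‖ = √|s|) :
    ‖((|s|⁻¹ : ℝ) : ℂ) * κ‖ = √|s⁻¹| := by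
  rw [norm_mul, Complex.norm_real, Real.norm_eq_abs, abs_inv, abs_abs, hκ, abs_inv, Real.sqrt_inv]
  have h1 : √|s| ≠ 0 := Real.sqrt_ne_zero'.2 (abs_pos.2 hs)
  have h2 : |s| ≠ 0 := abs_ne_zero.2 hs
  field_simp
  exact Real.sq_sqrt (abs_nonneg _)

/-- Substitute `r = s t`; the Jacobian `|s|⁻¹` is absorbed into the constant of the transposed
chirp. -/
theorem l2Pairing_chirpDil {s : ℝ} (hs : s ≠ 0) {κ : ℂ} (hκ : ‖κ‖ = √|s|) (α β : ℝ) (u v : L2R) :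
    l2Pairing (chirpDil hs hκ α β u) v = l2Pairing u
      (chirpDil (inv_ne_zero hs) (norm_transpose_eq_sqrt hs hκ) (α / s ^ 2) (β / s) v) := by
  have h1 : l2Pairing (chirpDil hs hκ α β u) v
      = ∫ t, (fun r => chirp κ α β (s⁻¹ * r) * u r * v (s⁻¹ * r)) (s * t) := by
    rw [l2Pairing_apply]
    refine integral_congr_ae ?_
    filter_upwards [coeFn_chirpDil hs hκ α β u] with t ht
    rw [ht]
    simp only [inv_mul_cancel_left₀ hs]
  rw [h1, Measure.integral_comp_mul_left
    (fun r => chirp κ α β (s⁻¹ * r) * u r * v (s⁻¹ * r)) s, l2Pairing_apply, ← integral_smul]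
  refine integral_congr_ae ?_
  filter_upwards [coeFn_chirpDil (inv_ne_zero hs) (norm_transpose_eq_sqrt hs hκ) (α / s ^ 2)
    (β / s) v] with r hr
  rw [hr, abs_inv]
  have e : chirp (((|s|⁻¹ : ℝ) : ℂ) * κ) (α / s ^ 2) (β / s) r
      = ((|s|⁻¹ : ℝ) : ℂ) * chirp κ α β (s⁻¹ * r) := by
    have e' : α / s ^ 2 * r ^ 2 + 2 * (β / s) * r = α * (s⁻¹ * r) ^ 2 + 2 * β * (s⁻¹ * r) := by
      field_simp
    rw [chirp, chirp, e', mul_assoc]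
  rw [e, Complex.real_smul]
  ring

/-- Expand the chirp about `x / s`: the cross term is linear in `t` and becomes a frequency shift,
and the remainder is a constant phase. -/
theorem chirp_mul_tfShift_dil {s : ℝ} (hs : s ≠ 0) (κ : ℂ) (α β : ℝ) (h : 𝓢(ℝ, ℂ)) (z : ℝ × ℝ)
    (t : ℝ) :
    chirp κ α β t * tfShift h z (s * t)
      = charFn (-1 / 2) (2 * β * (s⁻¹ * z.1) - α * (s⁻¹ * z.1) ^ 2)
        * (charFn (-(α / s) * z.1 + s * z.2) t
          * (chirp κ α β (t - s⁻¹ * z.1) * h (s * (t - s⁻¹ * z.1)))) := by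
  rw [tfShift_apply, show s * (t - s⁻¹ * z.1) = s * t - z.1 by field_simp]
  have e : charFn (-1 / 2) (α * t ^ 2 + 2 * β * t) * charFn z.2 (s * t)
      = charFn (-1 / 2) (2 * β * (s⁻¹ * z.1) - α * (s⁻¹ * z.1) ^ 2)
        * (charFn (-(α / s) * z.1 + s * z.2) t
          * charFn (-1 / 2) (α * (t - s⁻¹ * z.1) ^ 2 + 2 * β * (t - s⁻¹ * z.1))) := by
    have hs' : (s : ℂ) ≠ 0 := by exact_mod_cast hs
    simp only [charFn, ← Complex.exp_add]
    congr 1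
    push_cast
    field_simp
    ring
  simp only [chirp]
  linear_combination (κ * h (s * t - z.1)) * e

theorem permutesTFShifts_chirpDil {s : ℝ} (hs : s ≠ 0) {κ : ℂ} (hκ : ‖κ‖ = √|s|) (α β : ℝ) :
    PermutesTFShifts (chirpDil hs hκ α β) := by
  intro h
  set h₂ : 𝓢(ℝ, ℂ) := SchwartzMap.smulLeftCLM ℂ (chirp κ α β)
    (SchwartzMap.compCLMOfContinuousLinearEquiv ℂ
      (ContinuousLinearEquiv.unitsEquivAut ℝ (Units.mk0 s hs)) h) with hh₂
  have hh₂' : ∀ t, h₂ t = chirp κ α β t * h (s * t) := fun t => by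
    rw [hh₂, SchwartzMap.smulLeftCLM_apply_apply (chirp_hasTemperateGrowth κ α β)]
    simp [mul_comm]
  refine ⟨h₂, fun z => (s⁻¹ * z.1 + 0 * z.2, -(α / s) * z.1 + s * z.2),
    measurePreserving_of_abs_det_eq_one (by simp [hs]),
    fun z => ⟨_, norm_charFn (-1 / 2) (2 * β * (s⁻¹ * z.1) - α * (s⁻¹ * z.1) ^ 2), ?_⟩⟩
  apply Lp.ext
  filter_upwards [coeFn_chirpDil hs hκ α β ((tfShift h z).toLp 2),
    (quasiMeasurePreserving_mul_left hs).ae ((tfShift h z).coeFn_toLp 2 volume),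
    Lp.coeFn_smul (charFn (-1 / 2) (2 * β * (s⁻¹ * z.1) - α * (s⁻¹ * z.1) ^ 2))
      ((tfShift h₂ (s⁻¹ * z.1 + 0 * z.2, -(α / s) * z.1 + s * z.2)).toLp 2 volume),
    (tfShift h₂ (s⁻¹ * z.1 + 0 * z.2, -(α / s) * z.1 + s * z.2)).coeFn_toLp 2 volume]
    with t h1 h2 h3 h4
  rw [h1, h2, h3, Pi.smul_apply, h4, chirp_mul_tfShift_dil hs, tfShift_apply, hh₂', smul_eq_mul]
  simp

theorem isMetaplecticPair_chirpDil {s : ℝ} (hs : s ≠ 0) {κ : ℂ} (hκ : ‖κ‖ = √|s|) (α β : ℝ) :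
    IsMetaplecticPair (chirpDil hs hκ α β)
      (chirpDil (inv_ne_zero hs) (norm_transpose_eq_sqrt hs hκ) (α / s ^ 2) (β / s)) where
  pairing := l2Pairing_chirpDil hs hκ α β
  permutes := permutesTFShifts_chirpDil hs hκ α β
  permutes_symm := by
    rw [chirpDil_symm]
    exact permutesTFShifts_chirpDil _ _ _ _
  permutes_transpose := permutesTFShifts_chirpDil _ _ _ _
  permutes_transpose_symm := by
    rw [chirpDil_symm]
    exact permutesTFShifts_chirpDil _ _ _ _

/-- Multiplication of square integrable functions by the chirp `exp(πi (α t² + 2 β t))`. -/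
noncomputable def chirpMul (α β : ℝ) : L2R ≃ₗᵢ[ℂ] L2R :=
  chirpDil (s := 1) one_ne_zero (κ := 1) (by simp) α β

theorem coeFn_chirpMul (α β : ℝ) (f : L2R) :
    chirpMul α β f =ᵐ[volume] fun t => chirp 1 α β t * f t := by
  have h1 := coeFn_chirpDil (s := 1) one_ne_zero (κ := 1) (by simp) α β f
  simp only [one_mul] at h1
  exact h1

/-! ### The special affine Fourier transform -/

theorem norm_saftFactor (b : ℝ) : ‖1 / ((√|b| : ℝ) : ℂ)‖ = √|b⁻¹| := by
  rw [norm_div, norm_one, Complex.norm_real, Real.norm_of_nonneg (Real.sqrt_nonneg _), abs_inv,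
    Real.sqrt_inv, one_div]

/-- The special affine Fourier transform as a unitary operator on `L²(ℝ)`. -/
noncomputable def saftL2 (a b d p q : ℝ) (hb : b ≠ 0) : L2R ≃ₗᵢ[ℂ] L2R :=
  ((chirpMul (a / b) (p / b)).trans (Lp.fourierTransformₗᵢ ℝ ℂ)).trans
    (chirpDil (inv_ne_zero hb) (norm_saftFactor b) (d / b) ((b * q - d * p) / b))

/-- The SAFT exponent splits into a chirp in `t`, the Fourier kernel at frequency `ω / b`, and a
chirp in `ω`. -/
theorem saftL2_ae_eq (a b d p q : ℝ) (hb : b ≠ 0) (f : L2R) (hf : Integrable f volume) :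
    saftL2 a b d p q hb f =ᵐ[volume] saft a b d p q f := by
  set u : L2R := chirpMul (a / b) (p / b) f
  have hu : u =ᵐ[volume] fun t => chirp 1 (a / b) (p / b) t * f t := coeFn_chirpMul _ _ f
  have hui : Integrable u volume := by
    refine (hf.bdd_mul (c := 1) (continuous_chirp 1 (a / b) (p / b)).aestronglyMeasurable
      (Filter.Eventually.of_forall fun t => ?_)).congr hu.symm
    simp [norm_chirp]
  filter_upwards [coeFn_chirpDil (inv_ne_zero hb) (norm_saftFactor b) (d / b)
      ((b * q - d * p) / b) (𝓕 u),
    (quasiMeasurePreserving_mul_left (inv_ne_zero hb)).ae (fourier_ae_eq_of_integrable u hui)]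
    with ω h1 h2
  have hb' : (b : ℂ) ≠ 0 := by exact_mod_cast hb
  refine h1.trans ?_
  rw [h2, Real.fourier_eq', saft, chirp_eq, mul_assoc, ← integral_const_mul]
  congr 1
  refine integral_congr_ae ?_
  filter_upwards [hu] with t ht
  rw [ht, chirp_eq, one_mul, smul_eq_mul]
  have e : ∀ A B C D : ℂ, D = A + B + C → cexp A * (cexp B * (cexp C * f t)) = f t * cexp D := by
    intro A B C D hD
    rw [hD, Complex.exp_add, Complex.exp_add]
    ring
  apply e
  simp
  field_simp
  ring

theorem mainTheorem6 (a b c d p q : ℝ) (hdet : a * d - b * c = 1) (hb : b ≠ 0)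
    (g : 𝓢(ℝ, ℂ)) (hg : g ≠ 0) :
    ∃ j : S0 g →L[ℂ] L2R,
      (∀ f : S0 g, Lp.toTemperedDistribution (j f) = S0.toDistribution f) ∧
      IsBanachGelfandTriple j (dualEmbedding j) ∧
      (∃ F : L2R → L2R,
        (∀ f : L2R, Integrable f volume → F f =ᵐ[volume] saft a b d p q f) ∧
        IsGelfandTripleAutomorphism j (dualEmbedding j) F) ∧
      (∀ m : ℝ → ℂ, m = chirpLam a b ∨ m = chirpRho a b p ∨ m = chirpEta b d p q →
        ∃ M : L2R → L2R,
          (∀ f : L2R, M f =ᵐ[volume] fun t => m t * f t) ∧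
          IsGelfandTripleAutomorphism j (dualEmbedding j) M) := by
  have hb' : (b : ℂ) ≠ 0 := by exact_mod_cast hb
  refine ⟨S0.toL2 hg, S0.toTemperedDistribution_toL2 hg, S0.isBanachGelfandTriple hg,
    ⟨saftL2 a b d p q hb, saftL2_ae_eq a b d p q hb, ?_⟩, fun m hm => ?_⟩
  · exact (((isMetaplecticPair_chirpDil _ _ _ _).trans isMetaplecticPair_fourier).trans
      (isMetaplecticPair_chirpDil _ _ _ _)).isGelfandTripleAutomorphism hg
  · obtain ⟨α, β, hαβ⟩ : ∃ α β : ℝ, m = chirp 1 α β := by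
      rcases hm with rfl | rfl | rfl
      · refine ⟨a / b, 0, funext fun t => ?_⟩
        rw [chirp_eq, chirpLam, one_mul]
        congr 1
        push_cast
        field_simp
        ring
      · refine ⟨a / b, p / b, funext fun t => ?_⟩
        rw [chirp_eq, chirpRho, one_mul]
        congr 1
        push_cast
        field_simp
      · refine ⟨d / b, (b * q - d * p) / b, funext fun t => ?_⟩
        rw [chirp_eq, chirpEta, one_mul]
        congr 1
        push_cast
        field_simp
    refine ⟨chirpMul α β, fun f => ?_, ?_⟩
    · rw [hαβ]
      exact coeFn_chirpMul α β f
    · exact (isMetaplecticPair_chirpDil _ _ _ _).isGelfandTripleAutomorphism hg
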